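/- **Setting.** Let $p$ be an odd prime, $F_0$ a finite extension of $\mathbb Q_p$, $F/F_0$ the unramified quadratic extension, $a\mapsto\bar a$ its Galois conjugation, $v$ the normalized valuation of $F$, $\eta$ the quadratic character of $F_0^\times$ attached to $F/F_0$, $\psi_0:F_0\to\mathbb C^\times$ a continuous character of level zero (trivial on $O_{F_0}$, not on $\varpi^{-1}O_{F_0}$), and $\psi=\psi_0\circ\mathrm{tr}_{F/F_0}$. Let $m\ge1$, $r\ge0$, $n=m+1+2r$. *Unitary side.* Let $W$ be an $m$-dimensional $F/F_0$-Hermitian space, $W^\sharp=L\oplus W$ with $L=\langle e\rangle$, $(e,e)\in O_{F_0}^\times$, and $V=W^\sharp\oplus(E+E^\vee)$, where $E=\langle e_1,\dots,e_r\rangle$, $E^\vee=\langle e_1^\vee,\dots,e_r^\vee\rangle$ are totally isotropic, orthogonal to $W^\sharp$, and $(e_i,e_j^\vee)=\delta_{ij}$. Put $e_{r+1}=e$, $E_i=\langle e_1,\dots,e_i\rangle$. We suppose one of: - (split case) $W$ has a basis spanning a self-dual lattice. Together with the $e_i$ $(1\le i\le r+1)$ and $e_i^\vee$ it spans a self-dual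 lattice $\Lambda_0\subset V$; let $K_0$ be its stabilizer in $\mathrm U(V)$, and $f_V=\mathbf 1_{K_0}$; - (nonsplit case) the discriminant of $W$ is not a norm from $F^\times$; then put $f_V=0$. Let $H\subset \mathrm U(V)$ be the Bessel subgroup of all $h$ with $(h-1)e_i\in E_{i-1}$ for $1\le i\le r+1$; it maps to $\mathrm U(W)$ through its action on $E^\perp/E_{r+1}\simeq W$. For $h\in H$ let $\lambda(h)=\sum_{i=1}^r a_{i+1,i}$, where $he_{i+1}\equiv e_{i+1}+a_{i+1,i}e_i \bmod E_{i-1}$. Let $\mathbf H=H\times_{\mathrm U(W)}H$ and $$\mathrm{Orb}(g,f)=\int_{\mathbf H(F_0)}f(h_1^{-1}gh_2)\,\psi(\lambda(h_1^{-1}))\,\psi(\lambda(h_2))\,dh .$$ *Symmetric space side.* Let $S_n(F_0)=\{\gamma\in \mathrm{GL}_n(F):\gamma\bar\gamma=1\}$, and let $\mathbf H'(F_0)\subset\mathrm{GL}_n(F)$ be the group of block upper triangular matrices, with blocks of sizes $1^r,m+1,1^r$, whose diagonal blocks of size $1$ are $1$ and whose middle block is $\mathrm{diag}(1,D)$ with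 $D=D(h)\in\mathrm{GL}_m(F_0)$. Let $\lambda'(h)$ be the sum of the $2r$ superdiagonal entries of the matrix obtained from $h$ by deleting the $m$ rows and columns of $D$, and $$\mathrm{Orb}(\gamma,f',0)=\int_{\mathbf H'(F_0)}f'(h^{-1}\gamma\bar h)\,\psi(\lambda'(h))\,\eta(\det D(h))\,dh .$$ The Haar measures give volume $1$ to the integral points of $\mathbf H$ and $\mathbf H'$ (the elements whose matrices in the fixed bases lie in $\mathrm{GL}_n(O_F)$). *Normal forms and matching.* For $t_1,\dots,t_r\in F^\times$ and a matrix $A$ on $W^\sharp$ (in the basis consisting of $e$ and a basis of $W$), the normal form $(t,A)$ is the matrix, in the ordered basis $e_1,\dots,e_r$, basis of $W^\sharp$, $e_r^\vee,\dots,e_1^\vee$, that acts by $e_i^\vee\mapsto t_ie_i$, $e_i\mapsto\bar t_i^{-1}e_i^\vee$ and $A$ on $W^\sharp$. It is regular if $e,Ae,\dots,A^me$ and $e^\vee,e^\vee A,\dots,e^\vee A^m$ are bases, $e^\vee$ being the coordinate covector of $e$. Regular normal forms $g=(t,g^\sharp)\in \mathrm U(V)(F_0)$ and $\gamma=(t',\gamma^\sharp)\in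 S_n(F_0)$ match if $t=t'$ and $g^\sharp,\gamma^\sharp$ are conjugate under $\mathrm{GL}(W)=\mathrm{GL}_m(F)$. For regular $\gamma=(t,\gamma^\sharp)$ with unit $t_i$ the transfer factor is $\omega(\gamma)=(-1)^{v(\det(e,\gamma^\sharp e,\dots,(\gamma^\sharp)^me))}$. Let $\mathrm{FL}_{m,n}(g)$ be the statement (Liu's Bessel fundamental lemma at $g$) $$\mathrm{Orb}(g,f_V)=\omega(\gamma)\,\mathrm{Orb}(\gamma,\mathbf 1_{S_n(O_{F_0})},0)\quad\text{for all regular normal forms }\gamma\in S_n(F_0)\text{ matching }g .$$ The case $r=0$, $\mathrm{FL}_{m,m+1}(g^\sharp)$ with $f_{W^\sharp}$ in place of $f_V$, is the Jacquet–Rallis fundamental lemma at $g^\sharp$. **Proposition.** Let $g=(t,g^\sharp)\in \mathrm U(V)(F_0)$ be a regular normal form, and $\mathcal E^{0\flat}=O_Fe_1+\dots+O_Fe_r$. Then $\mathcal E^{0\flat}+g\mathcal E^{0\flat}$ is a unimodular (self-dual) lattice in $E+gE$ if and only if all $t_i$ are units. Suppose that this holds. Then $$\mathrm{Orb}(g,f_V)=\mathrm{Orb}(g^\sharp,f_{W^\sharp}),$$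 and $$\omega(\gamma)\,\mathrm{Orb}(\gamma,\mathbf 1_{S_n(O_{F_0})},0)=\omega(\gamma^\sharp)\,\mathrm{Orb}(\gamma^\sharp,\mathbf 1_{S_{m+1}(O_{F_0})},0)$$ for every regular normal form $\gamma=(t,\gamma^\sharp)\in S_n(F_0)$ matching $g$. Consequently $\mathrm{FL}_{m,n}(g)$ holds if and only if $\mathrm{FL}_{m,m+1}(g^\sharp)$ holds; in particular the former reduces to the latter. -/

import Mathlib

open Matrix MeasureTheory
open scoped Matrix

noncomputable section

namespace BesselFL

variable {F₀ F : Type*} [NormedField F₀] [NormedField F] [NormedAlgebra F₀ F]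
variable {r m : ℕ}

/-! ### Coordinates

All spaces come with a fixed basis: `e_1, …, e_r` of `E`, the vector `e_{r+1} = e` spanning `L`,
a basis of `W` (of dimension `m`), and `e_1^∨, …, e_r^∨`.  In the linear group the vector
`e_i^∨` is the standard basis vector `e_{n+1-i}`. -/

/-- Index set of the basis of `W^♯ = L ⊕ W`. -/
abbrev SharpIdx (m : ℕ) : Type := Unit ⊕ Fin m

/-- Index set of the basis of `V = E ⊕ W^♯ ⊕ E^∨`, of cardinality `n = m + 1 + 2r`. -/
abbrev Idx (r m : ℕ) : Type := Fin r ⊕ (SharpIdx m ⊕ Fin r)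

/-- The index of `e_i`, `1 ≤ i ≤ r`. -/
abbrev iE (i : Fin r) : Idx r m := Sum.inl i
/-- The index of `e_{r+1}`. -/
abbrev iL : Idx r m := Sum.inr (Sum.inl (Sum.inl ()))
/-- The index of a basis vector of `W`. -/
abbrev iW (a : Fin m) : Idx r m := Sum.inr (Sum.inl (Sum.inr a))
/-- The index of `e_i^∨`, `1 ≤ i ≤ r`. -/
abbrev iD (i : Fin r) : Idx r m := Sum.inr (Sum.inr i)

/-- The index of `e_{i+1}`, for `1 ≤ i ≤ r`. -/
def nextE (i : Fin r) : Idx r m := if h : i.1 + 1 < r then iE ⟨i.1 + 1, h⟩ else iL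

/-- The index of the vector before `e_i^∨` in the ordered basis
`e_1, …, e_r, e_{r+1}, e_r^∨, …, e_1^∨` of `V / W`. -/
def prevD (i : Fin r) : Idx r m := if h : i.1 + 1 < r then iD ⟨i.1 + 1, h⟩ else iL

/-- The block on `W` of an endomorphism of `V`. -/
def wBlock (g : Matrix (Idx r m) (Idx r m) F) : Matrix (Fin m) (Fin m) F :=
  Matrix.of fun a b => g (iW a) (iW b)

/-- A matrix in `GL(O_F)`: integral entries and unit determinant. -/
def IsIntegralMatrix {ι : Type*} [Fintype ι] [DecidableEq ι] (M : Matrix ι ι F) : Prop :=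
  (∀ i j, ‖M i j‖ ≤ 1) ∧ ‖M.det‖ = 1

/-! ### Hermitian spaces and unitary groups -/

/-- `J` is a Hermitian matrix for the Galois conjugation `σ`. -/
def IsHermitianMatrix (σ : F ≃ₐ[F₀] F) {ι : Type*} (J : Matrix ι ι F) : Prop :=
  (J.map σ)ᵀ = J

/-- The Gram matrix of `V = (E ⊕ E^∨) ⊕ L ⊕ W`: `(e_i, e_j^∨) = δ_ij`, `E` and `E^∨` are totally
isotropic, `(e, e) = c`, and `J` is the Gram matrix of `W`.  For `r = 0` this is `W^♯`. -/
def gram (c : F) (J : Matrix (Fin m) (Fin m) F) : Matrix (Idx r m) (Idx r m) F :=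
  Matrix.of fun x y => match x, y with
    | Sum.inl i, Sum.inr (Sum.inr j) => if i = j then 1 else 0
    | Sum.inr (Sum.inr i), Sum.inl j => if i = j then 1 else 0
    | Sum.inr (Sum.inl (Sum.inl _)), Sum.inr (Sum.inl (Sum.inl _)) => c
    | Sum.inr (Sum.inl (Sum.inr a)), Sum.inr (Sum.inl (Sum.inr b)) => J a b
    | _, _ => 0

/-- The Hermitian pairing with Gram matrix `G` (conjugate-linear in the first variable). -/
def herm (σ : F ≃ₐ[F₀] F) {ι : Type*} [Fintype ι] (G : Matrix ι ι F) (x y : ι → F) : F :=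
  (fun i => σ (x i)) ⬝ᵥ (G *ᵥ y)

/-- The matrices preserving the Hermitian pairing with Gram matrix `G`. -/
def unitaryMonoid (σ : F ≃ₐ[F₀] F) {ι : Type*} [Fintype ι] [DecidableEq ι] (G : Matrix ι ι F) :
    Submonoid (Matrix ι ι F) where
  carrier := {M | (M.map σ)ᵀ * G * M = G}
  one_mem' := by simp [Matrix.map_one]
  mul_mem' := by
    intro A B hA hB
    simp only [Set.mem_ofPred_eq] at hA hB ⊢
    have : ((A * B).map σ) = A.map σ * B.map σ := Matrix.map_mul (f := (σ : F →+* F))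
    rw [this, Matrix.transpose_mul]
    calc (B.map σ)ᵀ * (A.map σ)ᵀ * G * (A * B)
        = (B.map σ)ᵀ * ((A.map σ)ᵀ * G * A) * B := by simp only [Matrix.mul_assoc]
      _ = G := by rw [hA, hB]

/-! ### The Bessel subgroup of the unitary group -/

/-- The matrices `g` with `(g - 1) e_i ∈ E_{i-1}` for `1 ≤ i ≤ r + 1`, where
`E_i = ⟨e_1, …, e_i⟩`: they stabilise `E_1 ⊂ ⋯ ⊂ E_r ⊂ E^♯` and act trivially on the
graded pieces. -/
def besselMonoid (F : Type*) [Field F] (r m : ℕ) : Submonoid (Matrix (Idx r m) (Idx r m) F) where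
  carrier := {g |
    (∀ j : Fin r, g (iE j) (iE j) = 1 ∧ (∀ i : Fin r, j < i → g (iE i) (iE j) = 0) ∧
      ∀ x : SharpIdx m ⊕ Fin r, g (Sum.inr x) (iE j) = 0) ∧
    (∀ x : SharpIdx m ⊕ Fin r, g (Sum.inr x) iL = (1 : Matrix (Idx r m) (Idx r m) F)
      (Sum.inr x) iL)}
  one_mem' := by
    refine ⟨fun j => ⟨by simp, fun i hi => ?_, fun x => by simp⟩, fun x => rfl⟩
    exact Matrix.one_apply_ne (by simpa using hi.ne')
  mul_mem' := by
    rintro A B ⟨hA, hA'⟩ ⟨hB, hB'⟩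
    refine ⟨fun j => ⟨?_, fun i hi => ?_, fun x => ?_⟩, fun x => ?_⟩
    · rw [Matrix.mul_apply, Fintype.sum_sum_type, Finset.sum_eq_single j]
      · simp [(hA j).1, (hB j).1, (hB j).2.2]
      · intro k _ hk
        rcases lt_or_gt_of_ne hk with h | h
        · rw [(hA k).2.1 j h, zero_mul]
        · rw [(hB j).2.1 k h, mul_zero]
      · simp
    · rw [Matrix.mul_apply, Fintype.sum_sum_type, Finset.sum_eq_zero]
      · simp [(hB j).2.2]
      · intro k _
        rcases lt_or_ge j k with h | h
        · rw [(hB j).2.1 k h, mul_zero]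
        · rw [(hA k).2.1 i (lt_of_le_of_lt h hi), zero_mul]
    · rw [Matrix.mul_apply, Fintype.sum_sum_type]
      simp [(hA _).2.2, (hB j).2.2]
    · rw [Matrix.mul_apply, Fintype.sum_sum_type]
      simp only [(hA _).2.2, hB', zero_mul, Finset.sum_const_zero, zero_add]
      rw [Finset.sum_eq_single (Sum.inl (Sum.inl ()))]
      · rw [hA']; simp
      · intro y _ hy
        rw [Matrix.one_apply_ne (by simpa using hy), mul_zero]
      · simp

/-- The Bessel subgroup `H(F₀)` of `U(V)(F₀)`. -/
def besselH (r : ℕ) {m : ℕ} (σ : F ≃ₐ[F₀] F) (c : F) (J : Matrix (Fin m) (Fin m) F) :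
    Subgroup (GL (Idx r m) F) :=
  (unitaryMonoid σ (gram c J) ⊓ besselMonoid F r m).units

/-- An element of `H` stabilises `E^⊥`. -/
lemma besselH_perp {σ : F ≃ₐ[F₀] F} {c : F} {J : Matrix (Fin m) (Fin m) F}
    {h : GL (Idx r m) F} (hh : h ∈ besselH r σ c J) (i : Fin r) (a : Fin m) :
    (h : Matrix (Idx r m) (Idx r m) F) (iD i) (iW a) = 0 := by
  obtain ⟨h1, h2⟩ := (Submonoid.mem_units_iff _ _).1 hh
  have hu : (((h⁻¹ : GL (Idx r m) F) : Matrix (Idx r m) (Idx r m) F).map σ)ᵀ * gram c J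
      * ((h⁻¹ : GL (Idx r m) F) : Matrix (Idx r m) (Idx r m) F) = gram c J := h2.1
  have hb := h2.2.1 i
  have key : (((h⁻¹ : GL (Idx r m) F) : Matrix (Idx r m) (Idx r m) F).map σ)ᵀ * gram c J
      = gram c J * (h : Matrix (Idx r m) (Idx r m) F) := by
    conv_rhs => rw [← hu]
    rw [Matrix.mul_assoc _ _ (h : Matrix (Idx r m) (Idx r m) F), ← Units.val_mul,
      inv_mul_cancel, Units.val_one, Matrix.mul_one]
  have e := congrFun (congrFun key (iE i)) (iW a)
  rw [Matrix.mul_apply, Matrix.mul_apply] at e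
  simp only [Fintype.sum_sum_type, Matrix.transpose_apply, Matrix.map_apply, hb.2.2, gram,
    Matrix.of_apply] at e
  simpa using e.symm

/-- The map `g ↦ g|_{E^⊥ / E^♯}` is multiplicative on `H`. -/
lemma wBlock_mul {σ : F ≃ₐ[F₀] F} {c : F} {J : Matrix (Fin m) (Fin m) F}
    {g h : GL (Idx r m) F} (hg : g ∈ besselH r σ c J) (hh : h ∈ besselH r σ c J) :
    wBlock ((g * h : GL (Idx r m) F) : Matrix (Idx r m) (Idx r m) F)
      = wBlock (g : Matrix (Idx r m) (Idx r m) F) * wBlock (h : Matrix (Idx r m) (Idx r m) F) := by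
  obtain ⟨g1, -⟩ := (Submonoid.mem_units_iff _ _).1 hg
  have hb := g1.2
  ext a b
  simp only [wBlock, Matrix.of_apply, Units.val_mul, Matrix.mul_apply, Fintype.sum_sum_type]
  simp [(hb.1 _).2.2, hb.2, besselH_perp hh]

/-- The group `𝐇(F₀) = {(h₁, h₂) ∈ H × H : 𝔮(h₁) = 𝔮(h₂)}`, where `𝔮 : H → U(W)` is given by the
block on `W ≃ E^⊥ / E^♯`. -/
def boldH (r : ℕ) {m : ℕ} (σ : F ≃ₐ[F₀] F) (c : F) (J : Matrix (Fin m) (Fin m) F) :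
    Subgroup (GL (Idx r m) F × GL (Idx r m) F) where
  carrier := {h | h.1 ∈ besselH r σ c J ∧ h.2 ∈ besselH r σ c J ∧
    wBlock (h.1 : Matrix (Idx r m) (Idx r m) F) = wBlock (h.2 : Matrix (Idx r m) (Idx r m) F)}
  one_mem' := ⟨one_mem _, one_mem _, rfl⟩
  mul_mem' := by
    rintro x y ⟨hx1, hx2, hx⟩ ⟨hy1, hy2, hy⟩
    refine ⟨mul_mem hx1 hy1, mul_mem hx2 hy2, ?_⟩
    rw [Prod.fst_mul, Prod.snd_mul, wBlock_mul hx1 hy1, wBlock_mul hx2 hy2, hx, hy]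
  inv_mem' := by
    rintro x ⟨hx1, hx2, hx⟩
    refine ⟨inv_mem hx1, inv_mem hx2, ?_⟩
    have one : wBlock ((1 : GL (Idx r m) F) : Matrix (Idx r m) (Idx r m) F) = 1 := by
      ext a b
      simp [wBlock, Matrix.one_apply]
    have e1 := wBlock_mul (inv_mem hx1) hx1
    have e2 := wBlock_mul hx2 (inv_mem hx2)
    rw [inv_mul_cancel, one] at e1
    rw [mul_inv_cancel, one] at e2
    rw [← hx] at e2
    exact left_inv_eq_right_inv e1.symm e2.symm

instance (σ : F ≃ₐ[F₀] F) (c : F) (J : Matrix (Fin m) (Fin m) F) :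
    MeasurableSpace (boldH r σ c J) := borel _

instance (σ : F ≃ₐ[F₀] F) (c : F) (J : Matrix (Fin m) (Fin m) F) :
    BorelSpace (boldH r σ c J) := ⟨rfl⟩

/-- The integral points `𝐇(O_{F₀})`. -/
def boldHInt (r : ℕ) {m : ℕ} (σ : F ≃ₐ[F₀] F) (c : F) (J : Matrix (Fin m) (Fin m) F) :
    Set (boldH r σ c J) :=
  {h | IsIntegralMatrix (h.1.1 : Matrix (Idx r m) (Idx r m) F) ∧
    IsIntegralMatrix (h.1.2 : Matrix (Idx r m) (Idx r m) F)}

/-- `λ ∘ u : H → F`: the sum of the coefficients `a_{i+1,i}` in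
`h e_{i+1} ≡ e_{i+1} + a_{i+1,i} e_i mod E_{i-1}`, `1 ≤ i ≤ r`. -/
def lam (h : Matrix (Idx r m) (Idx r m) F) : F := ∑ i : Fin r, h (iE i) (nextE i)

/-- The character `(h₁, h₂) ↦ ψ(h₁⁻¹) ψ(h₂)` of `𝐇(F₀)`, with `ψ = ψ₀ ∘ tr ∘ λ ∘ u`. -/
def psiH (ψ₀ : AddChar F₀ ℂ) (h : GL (Idx r m) F × GL (Idx r m) F) : ℂ :=
  ψ₀ (Algebra.trace F₀ F (lam ((h.1⁻¹ : GL (Idx r m) F) : Matrix (Idx r m) (Idx r m) F))) *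
    ψ₀ (Algebra.trace F₀ F (lam (h.2 : Matrix (Idx r m) (Idx r m) F)))

/-- The orbital integral `Orb(g, f) = ∫_{𝐇(F₀)} f(h₁⁻¹ g h₂) ψ(h) dh`. -/
def orbU (σ : F ≃ₐ[F₀] F) (c : F) (J : Matrix (Fin m) (Fin m) F) (ψ₀ : AddChar F₀ ℂ)
    (μ : Measure (boldH r σ c J)) (g : Matrix (Idx r m) (Idx r m) F)
    (f : Matrix (Idx r m) (Idx r m) F → ℂ) : ℂ :=
  ∫ h : boldH r σ c J,
    f (((h.1.1⁻¹ : GL (Idx r m) F) : Matrix (Idx r m) (Idx r m) F) * g * h.1.2) *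
      psiH ψ₀ h.1 ∂μ

/-- `W` has Gram matrix `J ∈ GL_m(O_F)`, so that the basis spans a self-dual lattice. -/
def IsSplitGram (J : Matrix (Fin m) (Fin m) F) : Prop := IsIntegralMatrix J

/-- The discriminant of `W` is not a norm from `F^×`. -/
def IsNonsplitGram (σ : F ≃ₐ[F₀] F) (J : Matrix (Fin m) (Fin m) F) : Prop :=
  ¬ ∃ z : F, J.det = z * σ z

open Classical in
/-- The test function on `U(V)(F₀)`: for split `V`, the characteristic function of the stabiliser
`K₀` of the self-dual lattice spanned by the fixed basis of `V`; otherwise zero. -/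
def testU (r : ℕ) {m : ℕ} (σ : F ≃ₐ[F₀] F) (c : F) (J : Matrix (Fin m) (Fin m) F) :
    Matrix (Idx r m) (Idx r m) F → ℂ :=
  fun M => if IsSplitGram J ∧ M ∈ unitaryMonoid σ (gram c J) ∧ IsIntegralMatrix M then 1 else 0

/-! ### The symmetric space and the Bessel subgroup of the linear group -/

/-- The symmetric space `{γ : γ γ̄ = 1}`. -/
def symSpace (σ : F ≃ₐ[F₀] F) (ι : Type*) [Fintype ι] [DecidableEq ι] : Set (Matrix ι ι F) :=
  {γ | γ * γ.map σ = 1}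

open Classical in
/-- The characteristic function of the integral points of the symmetric space. -/
def testS (r m : ℕ) (σ : F ≃ₐ[F₀] F) : Matrix (Idx r m) (Idx r m) F → ℂ :=
  fun M => if M ∈ symSpace σ (Idx r m) ∧ IsIntegralMatrix M then 1 else 0

/-- Position in the flag `E_1 ⊂ ⋯ ⊂ E_r ⊂ E_{m+1+r} ⊂ E_{n-r+1} ⊂ ⋯ ⊂ E_n`. -/
def height : Idx r m → ℕ
  | Sum.inl i => i.1
  | Sum.inr (Sum.inl _) => r
  | Sum.inr (Sum.inr i) => 2 * r - i.1

/-- The shape of matrices in `𝐇'`: they stabilise the flag, act trivially on the graded pieces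
of rank one, and act on `E_{m+1+r} / E_r ≃ L ⊕ W` by `1 ⊕ D` with `D` a matrix over `F₀`. -/
def besselMonoid' (F₀ F : Type*) [NormedField F₀] [NormedField F] [NormedAlgebra F₀ F] (r m : ℕ) :
    Submonoid (Matrix (Idx r m) (Idx r m) F) where
  carrier := {g | (∀ x y, height y < height x → g x y = 0) ∧
    (∀ i, g (iE i) (iE i) = 1) ∧ (∀ i, g (iD i) (iD i) = 1) ∧ g iL iL = 1 ∧
    (∀ a, g iL (iW a) = 0) ∧ (∀ a, g (iW a) iL = 0) ∧
    (∀ a b, g (iW a) (iW b) ∈ (algebraMap F₀ F).range)}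
  one_mem' := by
    refine ⟨fun x y h => Matrix.one_apply_ne (by rintro rfl; exact lt_irrefl _ h),
      by simp, by simp, by simp, by simp, by simp, fun a b => ?_⟩
    rw [Matrix.one_apply]
    split_ifs
    · exact one_mem _
    · exact zero_mem _
  mul_mem' := by
    rintro A B ⟨hA, hA1, hA2, hA3, hA4, hA5, hA6⟩ ⟨hB, hB1, hB2, hB3, hB4, hB5, hB6⟩
    have hz : ∀ x y k : Idx r m, height y ≤ height x → height k ≠ height x →
        A x k * B k y = 0 := by
      intro x y k hxy hk
      rcases lt_or_gt_of_ne hk with h | h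
      · rw [hA x k h, zero_mul]
      · rw [hB k y (lt_of_le_of_lt hxy h), mul_zero]
    have hEne : ∀ (i : Fin r) (k : Idx r m), k ≠ iE i → height k ≠ height (iE i : Idx r m) := by
      rintro i (k | k | k) hk
      · simpa [height, Fin.ext_iff] using hk
      · simp only [height]; omega
      · simp only [height]; omega
    have hDne : ∀ (i : Fin r) (k : Idx r m), k ≠ iD i → height k ≠ height (iD i : Idx r m) := by
      rintro i (k | k | k) hk
      · simp only [height]; omega
      · simp only [height]; omega
      · have hk' : k.1 ≠ i.1 := by simpa [Fin.ext_iff] using hk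
        simp only [height]; omega
    have hsum : ∀ s t : SharpIdx m, (A * B) (Sum.inr (Sum.inl s)) (Sum.inr (Sum.inl t)) =
        ∑ k : SharpIdx m, A (Sum.inr (Sum.inl s)) (Sum.inr (Sum.inl k)) *
          B (Sum.inr (Sum.inl k)) (Sum.inr (Sum.inl t)) := by
      intro s t
      rw [Matrix.mul_apply, Fintype.sum_sum_type, Finset.sum_eq_zero, zero_add,
        Fintype.sum_sum_type, add_eq_left, Finset.sum_eq_zero]
      · intro k _
        exact hz _ _ _ (by simp [height]) (by simp only [height]; omega)
      · intro k _
        exact hz _ _ _ (by simp [height]) (by simp only [height]; omega)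
    refine ⟨fun x y hxy => ?_, fun i => ?_, fun i => ?_, ?_, fun a => ?_, fun a => ?_,
      fun a b => ?_⟩
    · rw [Matrix.mul_apply]
      refine Finset.sum_eq_zero fun k _ => ?_
      rcases lt_or_ge (height k) (height x) with h | h
      · rw [hA x k h, zero_mul]
      · rw [hB k y (lt_of_lt_of_le hxy h), mul_zero]
    · rw [Matrix.mul_apply, Finset.sum_eq_single (iE i), hA1, hB1, mul_one]
      · exact fun k _ hk => hz _ _ _ le_rfl (hEne i k hk)
      · simp
    · rw [Matrix.mul_apply, Finset.sum_eq_single (iD i), hA2, hB2, mul_one]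
      · exact fun k _ hk => hz _ _ _ le_rfl (hDne i k hk)
      · simp
    · rw [hsum]; simp [hA3, hA4, hB3]
    · rw [hsum]; simp [hA4, hB4]
    · rw [hsum]; simp [hA5, hB5]
    · rw [hsum, Fintype.sum_sum_type]
      simp only [hA5, zero_mul, Finset.sum_const_zero, zero_add]
      exact sum_mem fun k _ => mul_mem (hA6 _ _) (hB6 _ _)

/-- The group `𝐇'(F₀)`. -/
def boldH' (F₀ F : Type*) [NormedField F₀] [NormedField F] [NormedAlgebra F₀ F] (r m : ℕ) :
    Subgroup (GL (Idx r m) F) := (besselMonoid' F₀ F r m).units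

instance : MeasurableSpace (boldH' F₀ F r m) := borel _

instance : BorelSpace (boldH' F₀ F r m) := ⟨rfl⟩

/-- The integral points `𝐇'(O_{F₀})`. -/
def boldHInt' (F₀ F : Type*) [NormedField F₀] [NormedField F] [NormedAlgebra F₀ F] (r m : ℕ) :
    Set (boldH' F₀ F r m) :=
  {h | IsIntegralMatrix (h.1 : Matrix (Idx r m) (Idx r m) F)}

/-- `λ' ∘ u' : 𝐇' → F`: the sum of the superdiagonal entries of the endomorphism of `V / W`
in the ordered basis `e_1, …, e_r, e_{r+1}, e_r^∨, …, e_1^∨`. -/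
def lam' (h : Matrix (Idx r m) (Idx r m) F) : F :=
  ∑ i : Fin r, h (iE i) (nextE i) + ∑ i : Fin r, h (prevD i) (iD i)

open Classical in
/-- The quadratic character of `F₀^×` with kernel the norms from `F^×`, evaluated at an element
of `F₀^×` regarded as an element of `F`. -/
def eta (σ : F ≃ₐ[F₀] F) (x : F) : ℂ := if ∃ z : F, x = z * σ z then 1 else -1

/-- The orbital integral
`Orb(γ, f', 0) = ∫_{𝐇'(F₀)} f'(h⁻¹ γ h̄) ψ(λ'(u'(h))) η(det 𝔮'(h)) dh`. -/
def orbS (σ : F ≃ₐ[F₀] F) (ψ₀ : AddChar F₀ ℂ) (μ : Measure (boldH' F₀ F r m))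
    (γ : Matrix (Idx r m) (Idx r m) F) (f : Matrix (Idx r m) (Idx r m) F → ℂ) : ℂ :=
  ∫ h : boldH' F₀ F r m,
    f (((h.1⁻¹ : GL (Idx r m) F) : Matrix (Idx r m) (Idx r m) F) * γ *
        (h.1 : Matrix (Idx r m) (Idx r m) F).map σ) *
      ψ₀ (Algebra.trace F₀ F (lam' (h.1 : Matrix (Idx r m) (Idx r m) F))) *
      eta σ (wBlock (h.1 : Matrix (Idx r m) (Idx r m) F)).det ∂μ

/-! ### Normal forms, regularity, matching -/

/-- The normal form with invariants `t_i` and middle block `A` on `W^♯`: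
`e_i^∨ ↦ t_i e_i`, `e_i ↦ t̄_i⁻¹ e_i^∨`, and `A` on `W^♯`. -/
def normalForm (σ : F ≃ₐ[F₀] F) (t : Fin r → F) (A : Matrix (SharpIdx m) (SharpIdx m) F) :
    Matrix (Idx r m) (Idx r m) F :=
  Matrix.of fun x y => match x, y with
    | Sum.inl i, Sum.inr (Sum.inr j) => if i = j then t i else 0
    | Sum.inr (Sum.inr i), Sum.inl j => if i = j then (σ (t i))⁻¹ else 0
    | Sum.inr (Sum.inl x), Sum.inr (Sum.inl y) => A x y
    | _, _ => 0

/-- An element of `Mat_{m+1}(F)`, regarded in the case `r = 0`. -/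
def sharp (σ : F ≃ₐ[F₀] F) (A : Matrix (SharpIdx m) (SharpIdx m) F) :
    Matrix (Idx 0 m) (Idx 0 m) F := normalForm σ Fin.elim0 A

/-- The vector `e`, and also the covector `e^∨`, of `W ⊕ L`. -/
def eVec (F : Type*) [Field F] (m : ℕ) : SharpIdx m → F := Pi.single (Sum.inl ()) 1

/-- `ξ` is regular: `e, ξ e, …, ξ^m e` and `e^∨, e^∨ ξ, …, e^∨ ξ^m` are bases. -/
def IsRegular (ξ : Matrix (SharpIdx m) (SharpIdx m) F) : Prop :=
  LinearIndependent F (fun i : Fin (m + 1) => (ξ ^ i.1) *ᵥ eVec F m) ∧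
  LinearIndependent F (fun i : Fin (m + 1) => eVec F m ᵥ* (ξ ^ i.1))

/-- `g = normalForm σ t A` is a regular normal form in `U(V)(F₀)`.  A normal form is pre-regular
(it has trivial stabiliser in `N × N`), so regularity is a condition on `A` alone. -/
def IsRegularNormalFormU (σ : F ≃ₐ[F₀] F) (c : F) (J : Matrix (Fin m) (Fin m) F)
    (t : Fin r → F) (A : Matrix (SharpIdx m) (SharpIdx m) F) : Prop :=
  normalForm σ t A ∈ unitaryMonoid σ (gram c J) ∧ (∀ i, t i ≠ 0) ∧ IsRegular A

/-- `γ = normalForm σ t B` is a regular normal form in the symmetric space.  Again pre-regularity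
is automatic. -/
def IsRegularNormalFormS (σ : F ≃ₐ[F₀] F) (t : Fin r → F)
    (B : Matrix (SharpIdx m) (SharpIdx m) F) : Prop :=
  normalForm σ t B ∈ symSpace σ (Idx r m) ∧ (∀ i, t i ≠ 0) ∧ IsRegular B

/-- The normal forms with data `(t, A)` and `(t', B)` match: `t = t'`, and `A` and `B` are
conjugate under `GL_m(F) = GL(W)`. -/
def Matches (t : Fin r → F) (A : Matrix (SharpIdx m) (SharpIdx m) F)
    (t' : Fin r → F) (B : Matrix (SharpIdx m) (SharpIdx m) F) : Prop :=
  t = t' ∧ ∃ D : GL (Fin m) F,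
    A * Matrix.fromBlocks 1 0 0 (D : Matrix (Fin m) (Fin m) F) =
      Matrix.fromBlocks 1 0 0 (D : Matrix (Fin m) (Fin m) F) * B

open Classical in
/-- The transfer factor `(-1)^{v(det(e, γ^♯ e, …, (γ^♯)^m e))}` of a regular normal form `γ` with
unit invariants `t_i`; the columns are the `W^♯`-components of `γ^k e_{r+1}`, `0 ≤ k ≤ m`.  The
valuation of `d ≠ 0` is even exactly when `‖d‖` is the square of the norm of an element. -/
def transferFactor (γ : Matrix (Idx r m) (Idx r m) F) : ℂ :=
  if ∃ y : F, ‖(Matrix.of fun (x y : SharpIdx m) =>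
      (γ ^ (Sum.elim (fun _ => 0) (fun a : Fin m => a.1 + 1) y : ℕ))
        (Sum.inr (Sum.inl x)) iL).det‖ = ‖y‖ ^ 2
  then 1 else -1

/-- The fundamental lemma for the regular normal form `g` with data `(t, A)`: for every regular
normal form `γ` in the symmetric space matching `g`,
`Orb(g, f_V) = ω(γ) Orb(γ, 1_{S_n(O_{F₀})}, 0)`.  It is used for unit invariants `t_i` only.  For
`r = 0` it is the Jacquet–Rallis fundamental lemma at `A`. -/
def FundamentalLemmaAt (σ : F ≃ₐ[F₀] F) (c : F) (J : Matrix (Fin m) (Fin m) F)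
    (ψ₀ : AddChar F₀ ℂ) (μ : Measure (boldH r σ c J)) (μ' : Measure (boldH' F₀ F r m))
    (t : Fin r → F) (A : Matrix (SharpIdx m) (SharpIdx m) F) : Prop :=
  ∀ (t' : Fin r → F) (B : Matrix (SharpIdx m) (SharpIdx m) F),
    IsRegularNormalFormS σ t' B → Matches t A t' B →
    orbU σ c J ψ₀ μ (normalForm σ t A) (testU r σ c J) =
      transferFactor (normalForm σ t' B) *
        orbS σ ψ₀ μ' (normalForm σ t' B) (testS r m σ)

/-! ### The lattice condition, and characters of level zero -/

/-- The `O_F`-span of a family of vectors. -/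
def intSpan {ι κ : Type*} [Fintype κ] (v : κ → ι → F) : Set (ι → F) :=
  {x | ∃ a : κ → F, (∀ k, ‖a k‖ ≤ 1) ∧ x = ∑ k, a k • v k}

/-- `Λ` is unimodular in its `F`-span: there it equals its dual lattice. -/
def IsUnimodularLattice (σ : F ≃ₐ[F₀] F) {ι : Type*} [Fintype ι] (G : Matrix ι ι F)
    (Λ : Set (ι → F)) : Prop :=
  ∀ x ∈ Submodule.span F Λ, (∀ y ∈ Λ, ‖herm σ G x y‖ ≤ 1) ↔ x ∈ Λ

/-- The lattice `ℰ^{0♭} + g ℰ^{0♭}`, where `ℰ^{0♭}` is spanned over `O_F` by `e_1, …, e_r`. -/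
def flatLattice (g : Matrix (Idx r m) (Idx r m) F) : Set (Idx r m → F) :=
  intSpan (Sum.elim (fun i : Fin r => (Pi.single (iE i) 1 : Idx r m → F))
    (fun i : Fin r => g *ᵥ (Pi.single (iE i) 1 : Idx r m → F)))

/-- `ψ₀` is trivial on `O_{F₀}` but not on the inverse of the maximal ideal. -/
def IsLevelZero (ψ₀ : AddChar F₀ ℂ) : Prop :=
  (∀ x, ‖x‖ ≤ 1 → ψ₀ x = 1) ∧ ∃ x, (∀ y : F₀, ‖y‖ < 1 → ‖x * y‖ ≤ 1) ∧ ψ₀ x ≠ 1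

end BesselFL

end

/-!
Two facts carry the comparison of orbital integrals.

*Support.* An element of `𝐇(F₀)` is the product of the `D ∈ U(W)` by which it acts on `W` and of a
pair of unipotent elements; an element of `𝐇'(F₀)` is the product of some `D ∈ GL_m(F₀)` and of one
unipotent element, which enters the integrand together with its conjugate. Conjugation by `D` carries
the normal form `(t, A)` to `(t, D⁻¹AD)`, so integrality of `h₁⁻¹ g h₂` says that `n₁⁻¹ (t, A') n₂`
is integral for unipotent `n₁`, `n₂`. The lower left corner of this product is a factorisation
`L S U` with `L`, `U` unitriangular and `S` diagonal with entries `σ(tᵢ)⁻¹`. When these are units,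
`L` and `U` are integral, and the same recursion bounds whole rows of `n₂` and columns of `n₁⁻¹`
(`integral_of_lower_mul_diagonal_mul_upper`, `integral_rows_and_columns`). Unitarity
(`integral_rows_iff_columns`), respectively the equality `n₂ = n̄₁` on the symmetric space, gives both
rows and columns for a single element, and then all of it is integral
(`isIntegralMatrix_of_rows_and_columns`). Hence the integrand is supported on `U(W) · 𝐇(O_{F₀})`,
respectively on `GL_m(F₀) · 𝐇'(O_{F₀})`.

*Cosets.* The integrand is right invariant under the integral points: the characters `ψ` are trivial
there because `ψ₀` is trivial on `O_{F₀}`, and `η(det D)` is unchanged because units of `F₀` are norms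
from the unramified extension `F` (`exists_eq_mul_apply_of_norm_eq_one`). With the integral points of
volume one, both integrals are sums over cosets, and the sum for `r` runs over the same cosets as the
one for `r = 0` (`integral_eq_integral_comp_of_support`).

The transfer factor only sees the middle block of the normal form, and the lattice condition is read
off in coordinates (`isUnimodularLattice_flatLattice_iff`).
-/

namespace BesselFL

/-! ### Integration over the cosets of an open subgroup -/

section Cosets

variable {G : Type*} [Group G] [TopologicalSpace G] [IsTopologicalGroup G]

lemma countable_quotient_of_isOpen [SecondCountableTopology G] (K : Subgroup G)
    (hK : IsOpen (K : Set G)) : Countable (G ⧸ K) := by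
  have := QuotientGroup.discreteTopology hK
  have : TopologicalSpace.SeparableSpace (G ⧸ K) :=
    (QuotientGroup.isQuotientMap_mk (N := K)).separableSpace
  obtain ⟨s, hs, hd⟩ := TopologicalSpace.exists_countable_dense (G ⧸ K)
  rw [dense_discrete] at hd
  exact Set.countable_univ_iff.1 (hd ▸ hs)

variable [MeasurableSpace G] [BorelSpace G]

/-- A left invariant measure giving volume one to an open subgroup is pushed forward to the
counting measure on the cosets, so integrals of right invariant functions are sums over cosets
(without any hypothesis of integrability). -/
lemma integral_comp_mk_eq_integral_count (μ : Measure G) [μ.IsMulLeftInvariant] (K : Subgroup G)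
    (hK : IsOpen (K : Set G)) [Countable (G ⧸ K)] (hμ : μ K = 1) (f : G ⧸ K → ℂ) :
    ∫ g : G, f g ∂μ = ∫ x : G ⧸ K, f x ∂Measure.count := by
  have := QuotientGroup.discreteTopology hK
  have hcont : Continuous (QuotientGroup.mk : G → G ⧸ K) := continuous_quotient_mk'
  have : DiscreteMeasurableSpace (G ⧸ K) :=
    ⟨fun s => (isOpen_discrete s).preimage hcont |>.measurableSet⟩
  have hmeas : Measurable (QuotientGroup.mk : G → G ⧸ K) := QuotientGroup.measurable_coe
  have key : μ.map (QuotientGroup.mk : G → G ⧸ K) = Measure.count := by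
    refine Measure.ext_of_singleton fun x => ?_
    obtain ⟨g, rfl⟩ := QuotientGroup.mk_surjective x
    rw [Measure.map_apply hmeas (measurableSet_singleton _), Measure.count_singleton]
    have : (QuotientGroup.mk : G → G ⧸ K) ⁻¹' {(g : G ⧸ K)} = (fun h => g⁻¹ * h) ⁻¹' K := by
      ext h
      simp only [Set.mem_preimage, Set.mem_singleton_iff, SetLike.mem_coe]
      rw [eq_comm, QuotientGroup.eq]
    rw [this, measure_preimage_mul, hμ]
  rw [← key, integral_map hmeas.aemeasurable]
  exact (measurable_of_countable f).aestronglyMeasurable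

/-- Comparison of integrals over two groups: if `ι : G₀ → G` induces an injection `G₀/K₀ → G/K` of
coset spaces and `f` is a right `K`-invariant function supported on `ι(G₀)K`, then the integrals
of `f` and of `f ∘ ι` agree. -/
lemma integral_eq_integral_comp_of_support {G₀ : Type*} [Group G₀] [TopologicalSpace G₀]
    [IsTopologicalGroup G₀] [MeasurableSpace G₀] [BorelSpace G₀]
    [SecondCountableTopology G] [SecondCountableTopology G₀]
    (μ : Measure G) [μ.IsMulLeftInvariant] (μ₀ : Measure G₀) [μ₀.IsMulLeftInvariant]
    (K : Subgroup G) (K₀ : Subgroup G₀) (hK : IsOpen (K : Set G)) (hK₀ : IsOpen (K₀ : Set G₀))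
    (hμ : μ K = 1) (hμ₀ : μ₀ K₀ = 1) (ι : G₀ →* G) (hι : K.comap ι = K₀)
    (f : G → ℂ) (f₀ : G₀ → ℂ) (hf₀ : ∀ d, f (ι d) = f₀ d)
    (hinv : ∀ d, ∀ k ∈ K, f (ι d * k) = f (ι d))
    (hsupp : ∀ g, f g ≠ 0 → ∃ d, ∃ k ∈ K, g = ι d * k) :
    ∫ g, f g ∂μ = ∫ d, f₀ d ∂μ₀ := by
  have := countable_quotient_of_isOpen K hK
  have := countable_quotient_of_isOpen K₀ hK₀
  have hinv' : ∀ g, ∀ k ∈ K, f (g * k) = f g := by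
    intro g k hk
    by_cases h : ∃ d, ∃ k ∈ K, g = ι d * k
    · obtain ⟨d, k', hk', rfl⟩ := h
      rw [mul_assoc, hinv d _ (mul_mem hk' hk), hinv d _ hk']
    · have h1 : f g = 0 := by_contra fun h0 => h (hsupp g h0)
      rw [h1]
      by_contra h0
      obtain ⟨d, k', hk', e⟩ := hsupp _ h0
      exact h ⟨d, k' * k⁻¹, mul_mem hk' (inv_mem hk), by rw [← mul_assoc, ← e]; group⟩
  let F : G ⧸ K → ℂ := Quotient.lift f (by
    intro a b hab
    have h := QuotientGroup.leftRel_apply.1 hab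
    rw [← hinv' a _ h]
    group)
  have hF : ∀ g : G, F (g : G ⧸ K) = f g := fun g => rfl
  let j : G₀ ⧸ K₀ → G ⧸ K := Quotient.map' ι (by
    intro a b hab
    have h := QuotientGroup.leftRel_apply.1 hab
    rw [← hι, Subgroup.mem_comap] at h
    exact QuotientGroup.leftRel_apply.2 (by simpa using h))
  have hj : ∀ d : G₀, j (d : G₀ ⧸ K₀) = (ι d : G ⧸ K) := fun d => rfl
  have hjinj : Function.Injective j := by
    intro x y hxy
    obtain ⟨a, rfl⟩ := QuotientGroup.mk_surjective x
    obtain ⟨b, rfl⟩ := QuotientGroup.mk_surjective y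
    rw [hj, hj, QuotientGroup.eq] at hxy
    rw [QuotientGroup.eq, ← hι, Subgroup.mem_comap]
    simpa using hxy
  have hsF : ∀ x ∉ Set.range j, F x = 0 := by
    intro x hx
    obtain ⟨g, rfl⟩ := QuotientGroup.mk_surjective x
    by_contra h0
    rw [hF] at h0
    obtain ⟨d, k, hk, rfl⟩ := hsupp g h0
    refine hx ⟨d, ?_⟩
    rw [hj, QuotientGroup.eq]
    simpa using hk
  have := QuotientGroup.discreteTopology hK
  have := QuotientGroup.discreteTopology hK₀
  have : DiscreteMeasurableSpace (G ⧸ K) :=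
    ⟨fun s => (isOpen_discrete s).preimage continuous_quotient_mk' |>.measurableSet⟩
  have : DiscreteMeasurableSpace (G₀ ⧸ K₀) :=
    ⟨fun s => (isOpen_discrete s).preimage continuous_quotient_mk' |>.measurableSet⟩
  have hjm : MeasurableEmbedding j :=
    ⟨hjinj, measurable_of_countable j, fun _ _ => MeasurableSet.of_discrete⟩
  have hmap : Measure.count.map j = Measure.count.restrict (Set.range j) := by
    ext s hs
    rw [hjm.map_apply, Measure.restrict_apply hs, ← Set.image_preimage_eq_inter_range,
      Measure.count_injective_image hjinj]
  calc ∫ g, f g ∂μ = ∫ x, F x ∂Measure.count :=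
        integral_comp_mk_eq_integral_count μ K hK hμ F
    _ = ∫ x in Set.range j, F x ∂Measure.count :=
        (setIntegral_eq_integral_of_forall_compl_eq_zero hsF).symm
    _ = ∫ x, F (j x) ∂Measure.count := by rw [← hmap, hjm.integral_map]
    _ = ∫ d : G₀, F (j d) ∂μ₀ :=
        (integral_comp_mk_eq_integral_count μ₀ K₀ hK₀ hμ₀ fun x => F (j x)).symm
    _ = ∫ d, f₀ d ∂μ₀ := by simp only [hj, hF, hf₀]

end Cosets

/-! ### Unramified quadratic extensions -/

section Field

/-- Units congruent to one are squares, as `y ↦ y - (y² - x)/2` contracts the closed ball of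
radius `‖x - 1‖` around `1`. -/
lemma exists_sq_eq_of_norm_sub_one_lt {K : Type*} [NormedField K] [IsUltrametricDist K]
    [CompleteSpace K] (h2 : ‖(2 : K)‖ = 1) {x : K} (hx : ‖x - 1‖ < 1) : ∃ y : K, y ^ 2 = x := by
  have h20 : (2 : K) ≠ 0 := norm_ne_zero_iff.1 (by rw [h2]; exact one_ne_zero)
  have hadd : ∀ {a b : K} {C : ℝ}, ‖a‖ ≤ C → ‖b‖ ≤ C → ‖a + b‖ ≤ C := fun ha hb =>
    (IsUltrametricDist.norm_add_le_max _ _).trans (max_le ha hb)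
  set s := Metric.closedBall (1 : K) ‖x - 1‖ with hs
  have mem : ∀ y, y ∈ s ↔ ‖y - 1‖ ≤ ‖x - 1‖ := fun y => by rw [hs, mem_closedBall_iff_norm]
  let T : K → K := fun y => y - (y ^ 2 - x) / 2
  have hT1 : ∀ y, T y - 1 = (x - 1) / 2 + -((y - 1) * ((y - 1) / 2)) := fun y => by
    simp only [T]; field_simp; ring
  have hTs : Set.MapsTo T s s := by
    intro y hy
    rw [mem] at hy ⊢
    rw [hT1]
    refine hadd (by rw [norm_div, h2, div_one]) ?_
    rw [norm_neg, norm_mul, norm_div, h2, div_one]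
    exact (mul_le_of_le_one_right (norm_nonneg _) (hy.trans hx.le)).trans hy
  have hT2 : ∀ y z, T y - T z = (y - z) * -(((y - 1) + (z - 1)) / 2) := fun y z => by
    simp only [T]; field_simp; ring
  have hlip : LipschitzOnWith ⟨‖x - 1‖, norm_nonneg _⟩ T s := by
    refine LipschitzOnWith.of_dist_le_mul fun y hy z hz => ?_
    rw [mem] at hy hz
    rw [dist_eq_norm, dist_eq_norm, hT2, norm_mul, norm_neg, norm_div, h2, div_one, mul_comm]
    exact mul_le_mul_of_nonneg_right (hadd hy hz) (norm_nonneg _)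
  have hcon : ContractingWith ⟨‖x - 1‖, norm_nonneg _⟩ (hTs.restrict T s s) :=
    ⟨by exact_mod_cast hx, hTs.lipschitzOnWith_iff_restrict.1 hlip⟩
  have h1 : (1 : K) ∈ s := by rw [mem]; simp
  obtain ⟨y, -, hfix, -⟩ := hcon.exists_fixedPoint' Metric.isClosed_closedBall.isComplete hTs h1
    (edist_ne_top _ _)
  refine ⟨y, ?_⟩
  have : y - (y ^ 2 - x) / 2 = y := hfix
  have h3 : (y ^ 2 - x) / 2 = 0 := by simpa using this
  have := (div_eq_zero_iff.1 h3).resolve_right h20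
  exact sub_eq_zero.1 this

open scoped NormedField Valued in
/-- Over a local field of odd residue characteristic, the form `x² - d y²` with `d` a unit
represents every unit: it does so over the finite residue field, and solutions lift. -/
lemma exists_sq_sub_mul_sq_eq {K : Type*} [NontriviallyNormedField K] [IsUltrametricDist K]
    [ProperSpace K] (h2 : ‖(2 : K)‖ = 1) {u d : K} (hu : ‖u‖ = 1) (hd : ‖d‖ = 1) :
    ∃ x y : K, u = x ^ 2 - d * y ^ 2 := by
  have hcpt : CompactSpace 𝒪[K] := by
    have h : IsCompact (𝒪[K] : Set K) := by
      convert isCompact_closedBall (0 : K) 1 using 1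
      ext x
      simp [Valued.integer.mem_iff]
    exact isCompact_iff_compactSpace.1 h
  let : (Valued.v : Valuation K _).RankOne :=
    inferInstanceAs (NormedField.valuation (K := K)).RankOne
  have hfin : Finite 𝓀[K] :=
    (Valued.integer.compactSpace_iff_completeSpace_and_isDiscreteValuationRing_and_finite_residueField.1
      hcpt).2.2
  have := Fintype.ofFinite 𝓀[K]
  have res0 : ∀ a : 𝒪[K], IsLocalRing.residue 𝒪[K] a = 0 → ‖(a : K)‖ < 1 := by
    intro a ha
    refine lt_of_le_of_ne (Valued.integer.mem_iff.1 a.2) fun h1 => ?_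
    rw [IsLocalRing.residue_eq_zero_iff] at ha
    exact ha (Valued.integer.isUnit_iff_norm_eq_one.2 h1)
  have hne : ∀ a : 𝒪[K], ‖(a : K)‖ = 1 → IsLocalRing.residue 𝒪[K] a ≠ 0 := fun a ha h0 =>
    (res0 a h0).ne ha
  let u' : 𝒪[K] := ⟨u, Valued.integer.mem_iff.2 hu.le⟩
  let d' : 𝒪[K] := ⟨d, Valued.integer.mem_iff.2 hd.le⟩
  have hodd : Fintype.card 𝓀[K] % 2 = 1 := by
    apply FiniteField.odd_card_of_char_ne_two
    intro hc
    have : ((2 : ℕ) : 𝓀[K]) = 0 := by rw [← hc]; exact ringChar.Nat.cast_ringChar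
    refine hne 2 h2 ?_
    rw [← this, map_ofNat, Nat.cast_ofNat]
  obtain ⟨a, b, hab⟩ := FiniteField.exists_root_sum_quadratic
    (f := Polynomial.X ^ 2 - Polynomial.C (IsLocalRing.residue 𝒪[K] u'))
    (g := Polynomial.C (-IsLocalRing.residue 𝒪[K] d') * Polynomial.X ^ 2)
    (Polynomial.degree_X_pow_sub_C (by norm_num) _)
    (Polynomial.degree_C_mul_X_pow 2 (neg_ne_zero.2 (hne d' hd))) hodd
  obtain ⟨x, rfl⟩ := IsLocalRing.residue_surjective a
  obtain ⟨y, rfl⟩ := IsLocalRing.residue_surjective b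
  have key : ‖(x : K) ^ 2 - u - d * (y : K) ^ 2‖ < 1 := by
    refine res0 (x ^ 2 - u' - d' * y ^ 2) ?_
    simp only [Polynomial.eval_sub, Polynomial.eval_pow, Polynomial.eval_X, Polynomial.eval_C,
      Polynomial.eval_mul] at hab
    simp only [map_sub, map_pow, map_mul]
    linear_combination hab
  have hx : ‖(x : K)‖ ≤ 1 := Valued.integer.mem_iff.1 x.2
  rcases hx.eq_or_lt with h1 | h1
  · have hx0 : (x : K) ≠ 0 := norm_ne_zero_iff.1 (by rw [h1]; exact one_ne_zero)
    obtain ⟨s, hs⟩ := exists_sq_eq_of_norm_sub_one_lt h2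
      (x := (u + d * (y : K) ^ 2) / (x : K) ^ 2) (by
        have : (u + d * (y : K) ^ 2) / (x : K) ^ 2 - 1
            = -((x : K) ^ 2 - u - d * (y : K) ^ 2) / (x : K) ^ 2 := by field_simp; ring
        rw [this, norm_div, norm_neg, norm_pow, h1]
        simpa using key)
    refine ⟨s * x, y, ?_⟩
    rw [mul_pow, hs]
    field_simp
    ring
  · have hdy : ‖d * (y : K) ^ 2‖ = 1 := by
      have e : d * (y : K) ^ 2
          = -u + ((x : K) ^ 2 + -((x : K) ^ 2 - u - d * (y : K) ^ 2)) := by ring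
      have hlt : ‖(x : K) ^ 2 + -((x : K) ^ 2 - u - d * (y : K) ^ 2)‖ < ‖-u‖ := by
        rw [norm_neg, hu]
        refine (IsUltrametricDist.norm_add_le_max _ _).trans_lt (max_lt ?_ (by rwa [norm_neg]))
        rw [norm_pow]
        exact pow_lt_one₀ (norm_nonneg _) h1 two_ne_zero
      rw [e, IsUltrametricDist.norm_add_eq_max_of_norm_ne_norm hlt.ne', max_eq_left hlt.le,
        norm_neg, hu]
    have hdy0 : d * (y : K) ^ 2 ≠ 0 := norm_ne_zero_iff.1 (by rw [hdy]; exact one_ne_zero)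
    obtain ⟨s, hs⟩ := exists_sq_eq_of_norm_sub_one_lt h2
      (x := ((x : K) ^ 2 - u) / (d * (y : K) ^ 2)) (by
        have : ((x : K) ^ 2 - u) / (d * (y : K) ^ 2) - 1
            = ((x : K) ^ 2 - u - d * (y : K) ^ 2) / (d * (y : K) ^ 2) := by
          rw [div_sub_one hdy0]
        rw [this, norm_div, hdy]
        simpa using key)
    refine ⟨x, s * y, ?_⟩
    rw [mul_pow, hs]
    have := div_mul_cancel₀ ((x : K) ^ 2 - u) hdy0
    linear_combination this

variable {F₀ F : Type*} [NormedField F₀] [NormedField F] [NormedAlgebra F₀ F]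

lemma isGalois_of_finrank_eq_two (hdeg : Module.finrank F₀ F = 2) {σ : F ≃ₐ[F₀] F}
    (hσ : σ ≠ AlgEquiv.refl) : IsGalois F₀ F ∧ ∀ τ : F ≃ₐ[F₀] F, τ = 1 ∨ τ = σ := by
  have : FiniteDimensional F₀ F := FiniteDimensional.of_finrank_pos (by omega)
  classical
  have hle : Fintype.card (F ≃ₐ[F₀] F) ≤ 2 := hdeg ▸ AlgEquiv.card_le
  have hcard : ({1, σ} : Finset (F ≃ₐ[F₀] F)).card = 2 := Finset.card_pair (Ne.symm hσ)
  have huniv : ({1, σ} : Finset (F ≃ₐ[F₀] F)) = Finset.univ :=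
    Finset.eq_univ_of_card _ (le_antisymm (Finset.card_le_univ _) (hcard ▸ hle))
  refine ⟨IsGalois.of_card_aut_eq_finrank _ _ ?_, fun τ => ?_⟩
  · rw [hdeg, Nat.card_eq_fintype_card, ← Finset.card_univ, ← huniv, hcard]
  · have h := Finset.mem_univ τ
    rw [← huniv] at h
    simpa using h

lemma apply_apply_of_finrank_eq_two (hdeg : Module.finrank F₀ F = 2) {σ : F ≃ₐ[F₀] F}
    (hσ : σ ≠ AlgEquiv.refl) (x : F) : σ (σ x) = x := by
  rcases (isGalois_of_finrank_eq_two hdeg hσ).2 (σ * σ) with h | h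
  · exact DFunLike.congr_fun h x
  · exact absurd (mul_eq_left.1 h) hσ

lemma mem_range_of_apply_eq (hdeg : Module.finrank F₀ F = 2) {σ : F ≃ₐ[F₀] F}
    (hσ : σ ≠ AlgEquiv.refl) {x : F} (hx : σ x = x) : ∃ y : F₀, algebraMap F₀ F y = x := by
  have : FiniteDimensional F₀ F := FiniteDimensional.of_finrank_pos (by omega)
  obtain ⟨hG, hτ⟩ := isGalois_of_finrank_eq_two hdeg hσ
  rw [← Set.mem_range, ← IntermediateField.mem_bot, IsGalois.mem_bot_iff_fixed]
  intro τ
  rcases hτ τ with rfl | rfl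
  · rfl
  · exact hx

/-- Automorphisms are isometric: they are bounded, and `‖τ x‖ⁿ ≤ C ‖x‖ⁿ` for all `n`. -/
lemma norm_algEquiv_apply [CompleteSpace F₀] [FiniteDimensional F₀ F]
    (hnt : ∃ x : F₀, 1 < ‖x‖) (τ : F ≃ₐ[F₀] F) (x : F) : ‖τ x‖ = ‖x‖ := by
  let : NontriviallyNormedField F₀ := { ‹NormedField F₀› with non_trivial := hnt }
  have hle : ∀ (τ : F ≃ₐ[F₀] F) (x : F), ‖τ x‖ ≤ ‖x‖ := by
    intro τ x
    obtain ⟨C, hC⟩ : ∃ C, ∀ y, ‖τ y‖ ≤ C * ‖y‖ :=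
      ⟨_, (LinearMap.toContinuousLinearMap τ.toLinearMap).le_opNorm⟩
    by_contra! h
    rcases eq_or_ne x 0 with rfl | hx
    · simp at h
    have hx' : 0 < ‖x‖ := norm_pos_iff.2 hx
    have h1 : 1 < ‖τ x‖ / ‖x‖ := (one_lt_div hx').2 h
    obtain ⟨n, hn⟩ := pow_unbounded_of_one_lt C h1
    have := hC (x ^ n)
    rw [map_pow, norm_pow, norm_pow, ← div_le_iff₀ (pow_pos hx' n), ← div_pow] at this
    exact absurd this (not_le.2 hn)
  exact le_antisymm (hle τ x) (by simpa using hle τ.symm (τ x))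

lemma norm_trace_le_one [IsUltrametricDist F] [FiniteDimensional F₀ F] [IsGalois F₀ F]
    (hiso : ∀ (τ : F ≃ₐ[F₀] F) (x : F), ‖τ x‖ = ‖x‖) {x : F} (hx : ‖x‖ ≤ 1) :
    ‖Algebra.trace F₀ F x‖ ≤ 1 := by
  rw [← norm_algebraMap' F, trace_eq_sum_automorphisms]
  exact IsUltrametricDist.norm_sum_le_of_forall_le_of_nonneg zero_le_one
    fun τ _ => by rw [hiso]; exact hx

/-- Units of the base field are norms from an unramified quadratic extension. -/
lemma exists_eq_mul_apply_of_norm_eq_one [IsUltrametricDist F₀] [ProperSpace F₀]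
    (hnt : ∃ x : F₀, 1 < ‖x‖) (h2 : ‖(2 : F₀)‖ = 1)
    (hdeg : Module.finrank F₀ F = 2) (hunram : ∀ x : F, ∃ y : F₀, ‖x‖ = ‖y‖)
    {σ : F ≃ₐ[F₀] F} (hσ : σ ≠ AlgEquiv.refl) {u : F₀} (hu : ‖u‖ = 1) :
    ∃ z : F, algebraMap F₀ F u = z * σ z := by
  let : NontriviallyNormedField F₀ := { ‹NormedField F₀› with non_trivial := hnt }
  obtain ⟨w, hw⟩ : ∃ w, σ w ≠ w := by
    by_contra! h
    exact hσ (AlgEquiv.ext h)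
  obtain ⟨y, hy⟩ := hunram (w - σ w)
  have hw0 : w - σ w ≠ 0 := sub_ne_zero.2 (Ne.symm hw)
  have hy0 : y ≠ 0 := by
    rw [← norm_ne_zero_iff, ← hy, norm_ne_zero_iff]; exact hw0
  -- `δ` is a unit with `σ δ = - δ`, so that `F = F₀(√d)` with `d` a unit.
  set δ := (w - σ w) / algebraMap F₀ F y with hδ
  have hδσ : σ δ = -δ := by
    rw [hδ, map_div₀, map_sub, apply_apply_of_finrank_eq_two hdeg hσ, AlgEquiv.commutes,
      ← neg_div, neg_sub]
  have hδ1 : ‖δ‖ = 1 := by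
    rw [hδ, norm_div, norm_algebraMap', hy, div_self (norm_ne_zero_iff.2 hy0)]
  obtain ⟨d, hd⟩ := mem_range_of_apply_eq hdeg hσ (x := δ ^ 2) (by rw [map_pow, hδσ, neg_sq])
  have hd1 : ‖d‖ = 1 := by rw [← norm_algebraMap' F, hd, norm_pow, hδ1, one_pow]
  obtain ⟨a, b, hab⟩ := exists_sq_sub_mul_sq_eq h2 hu hd1
  refine ⟨algebraMap F₀ F a + algebraMap F₀ F b * δ, ?_⟩
  rw [map_add, map_mul, AlgEquiv.commutes, AlgEquiv.commutes, hδσ, hab, map_sub, map_mul, hd,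
    map_pow, map_pow]
  ring

end Field

/-! ### Integral matrices -/

section Integral

variable {F : Type*} [NormedField F] [IsUltrametricDist F]
variable {ι : Type*} [Fintype ι] [DecidableEq ι]

omit [DecidableEq ι] in
lemma norm_mul_apply_le_one {α β : Type*} {A : Matrix α ι F} {B : Matrix ι β F} {i : α} {j : β}
    (hA : ∀ k, ‖A i k‖ ≤ 1) (hB : ∀ k, ‖B k j‖ ≤ 1) : ‖(A * B) i j‖ ≤ 1 := by
  rw [Matrix.mul_apply]
  refine IsUltrametricDist.norm_sum_le_of_forall_le_of_nonneg zero_le_one fun k _ => ?_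
  rw [norm_mul]
  exact mul_le_one₀ (hA k) (norm_nonneg _) (hB k)

lemma norm_det_le_one {M : Matrix ι ι F} (hM : ∀ i j, ‖M i j‖ ≤ 1) : ‖M.det‖ ≤ 1 := by
  rw [Matrix.det_apply]
  refine IsUltrametricDist.norm_sum_le_of_forall_le_of_nonneg zero_le_one fun τ _ => ?_
  have hprod : ‖∏ i, M (τ i) i‖ ≤ 1 := by
    rw [norm_prod]
    exact Finset.prod_le_one (fun _ _ => norm_nonneg _) fun _ _ => hM _ _
  rcases Int.units_eq_one_or (Equiv.Perm.sign τ) with h | h <;> simpa [h] using hprod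

omit [IsUltrametricDist F] in
lemma isIntegralMatrix_one : IsIntegralMatrix (1 : Matrix ι ι F) := by
  refine ⟨fun i j => ?_, by simp⟩
  rw [Matrix.one_apply]
  split_ifs <;> simp

lemma IsIntegralMatrix.mul {M N : Matrix ι ι F} (hM : IsIntegralMatrix M)
    (hN : IsIntegralMatrix N) : IsIntegralMatrix (M * N) :=
  ⟨fun i j => norm_mul_apply_le_one (fun k => hM.1 i k) (fun k => hN.1 k j), by
    rw [Matrix.det_mul, norm_mul, hM.2, hN.2, one_mul]⟩

lemma IsIntegralMatrix.of_mul_eq_one {M N : Matrix ι ι F} (hM : IsIntegralMatrix M)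
    (h : M * N = 1) : IsIntegralMatrix N := by
  have hdet : M.det * N.det = 1 := by rw [← Matrix.det_mul, h, Matrix.det_one]
  have hM0 : IsUnit M.det := IsUnit.of_mul_eq_one _ hdet
  have hN : N = M.det⁻¹ • M.adjugate := by
    rw [← Ring.inverse_eq_inv', ← Matrix.inv_def]
    exact (Matrix.inv_eq_right_inv h).symm
  refine ⟨fun i j => ?_, ?_⟩
  · rw [hN, Matrix.smul_apply, smul_eq_mul, norm_mul, norm_inv, hM.2, inv_one, one_mul,
      Matrix.adjugate_apply]
    refine norm_det_le_one fun a b => ?_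
    rw [Matrix.updateRow_apply]
    split_ifs
    · rw [Pi.single_apply]; split_ifs <;> simp
    · exact hM.1 a b
  · have := congrArg norm hdet
    rwa [norm_mul, hM.2, one_mul, norm_one] at this

lemma isIntegralMatrix_of_mul_eq_one {M N : Matrix ι ι F} (hM : ∀ i j, ‖M i j‖ ≤ 1)
    (hN : ∀ i j, ‖N i j‖ ≤ 1) (h : M * N = 1) : IsIntegralMatrix M := by
  refine ⟨hM, le_antisymm (norm_det_le_one hM) ?_⟩
  have hdet : ‖M.det‖ * ‖N.det‖ = 1 := by
    rw [← norm_mul, ← Matrix.det_mul, h, Matrix.det_one, norm_one]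
  calc 1 = ‖M.det‖ * ‖N.det‖ := hdet.symm
    _ ≤ ‖M.det‖ := mul_le_of_le_one_right (norm_nonneg _) (norm_det_le_one hN)

lemma IsIntegralMatrix.inv {g : GL ι F} (hg : IsIntegralMatrix (g : Matrix ι ι F)) :
    IsIntegralMatrix ((g⁻¹ : GL ι F) : Matrix ι ι F) :=
  hg.of_mul_eq_one (by rw [← Units.val_mul, mul_inv_cancel, Units.val_one])

omit [IsUltrametricDist F] in
lemma norm_det_map {σ : F →+* F} (hσ : ∀ x, ‖σ x‖ = ‖x‖) (M : Matrix ι ι F) :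
    ‖(M.map σ).det‖ = ‖M.det‖ := by
  rw [← hσ M.det, RingHom.map_det]; rfl

omit [IsUltrametricDist F] in
lemma IsIntegralMatrix.map {σ : F →+* F} (hσ : ∀ x, ‖σ x‖ = ‖x‖) {M : Matrix ι ι F}
    (hM : IsIntegralMatrix M) : IsIntegralMatrix (M.map σ) :=
  ⟨fun i j => by rw [Matrix.map_apply, hσ]; exact hM.1 i j, by rw [norm_det_map hσ]; exact hM.2⟩

/-- The group `GL(O_F)` as a subgroup of `GL(F)`. -/
def integralGL (ι F : Type*) [Fintype ι] [DecidableEq ι] [NormedField F] [IsUltrametricDist F] :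
    Subgroup (GL ι F) where
  carrier := {g | IsIntegralMatrix (g : Matrix ι ι F)}
  one_mem' := isIntegralMatrix_one
  mul_mem' ha hb := ha.mul hb
  inv_mem' ha := ha.inv

lemma isOpen_integralGL : IsOpen (integralGL ι F : Set (GL ι F)) := by
  have h1 : IsOpen {x : F | ‖x‖ ≤ 1} := by
    simpa [Metric.closedBall, dist_zero_right] using
      IsUltrametricDist.isOpen_closedBall (0 : F) one_ne_zero
  have h2 : IsOpen {x : F | ‖x‖ = 1} := by
    simpa [Metric.sphere, dist_zero_right] using
      IsUltrametricDist.isOpen_sphere (0 : F) one_ne_zero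
  have hval : Continuous fun g : GL ι F => (g : Matrix ι ι F) := Units.continuous_val
  have : (integralGL ι F : Set (GL ι F)) =
      (⋂ i, ⋂ j, (fun g : GL ι F => (g : Matrix ι ι F) i j) ⁻¹' {x | ‖x‖ ≤ 1}) ∩
        (fun g : GL ι F => (g : Matrix ι ι F).det) ⁻¹' {x | ‖x‖ = 1} := by
    ext g
    simp [integralGL, IsIntegralMatrix]
  rw [this]
  exact (isOpen_iInter_of_finite fun i => isOpen_iInter_of_finite fun j =>
    h1.preimage (hval.matrix_elem i j)).inter (h2.preimage hval.matrix_det)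

end Integral

lemma secondCountableTopology_GL (ι F : Type*) [Fintype ι] [DecidableEq ι] [NormedField F]
    [SecondCountableTopology F] : SecondCountableTopology (GL ι F) := by
  have : SecondCountableTopology (Matrix ι ι F) :=
    inferInstanceAs (SecondCountableTopology (ι → ι → F))
  have : SecondCountableTopology (Matrix ι ι F)ᵐᵒᵖ :=
    MulOpposite.opHomeomorph.symm.isEmbedding.secondCountableTopology
  exact Units.isEmbedding_embedProduct.secondCountableTopology

/-! ### The parabolic shape and triangular factorisation -/

section Parabolic

variable {F₀ F : Type*} [NormedField F₀] [NormedField F] [NormedAlgebra F₀ F]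
variable {r m : ℕ}

/-- The block-diagonal matrix acting by `D` on `W` and trivially on the other basis vectors. -/
def embedW (r : ℕ) {m : ℕ} : Matrix (Fin m) (Fin m) F →* Matrix (Idx r m) (Idx r m) F where
  toFun D := fromBlocks 1 0 0 (fromBlocks (fromBlocks 1 0 0 D) 0 0 1)
  map_one' := by simp only [fromBlocks_one]
  map_mul' A B := by simp [fromBlocks_multiply]

/-- `embedW` on invertible matrices. -/
def embedGL (F : Type*) [NormedField F] (r m : ℕ) : GL (Fin m) F →* GL (Idx r m) F :=
  Units.map (embedW r)

lemma embedW_apply (D : Matrix (Fin m) (Fin m) F) :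
    embedW r D = fromBlocks 1 0 0 (fromBlocks (fromBlocks 1 0 0 D) 0 0 1) := rfl

@[simp] lemma wBlock_embedW (D : Matrix (Fin m) (Fin m) F) : wBlock (embedW r D) = D := by
  ext a b; rfl

lemma coe_embedGL (D : GL (Fin m) F) :
    (embedGL F r m D : Matrix (Idx r m) (Idx r m) F) = embedW r (D : Matrix (Fin m) (Fin m) F) :=
  rfl

lemma coe_inv_embedGL (D : GL (Fin m) F) :
    ((embedGL F r m D)⁻¹ : GL (Idx r m) F).val
      = embedW r ((D⁻¹ : GL (Fin m) F) : Matrix (Fin m) (Fin m) F) := rfl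

lemma embedW_mul_iE (D : Matrix (Fin m) (Fin m) F) (M : Matrix (Idx r m) (Idx r m) F) (i : Fin r)
    (y : Idx r m) : (embedW r D * M) (iE i) y = M (iE i) y := by
  simp [Matrix.mul_apply, Fintype.sum_sum_type, embedW_apply, Matrix.one_apply]

lemma embedW_mul_iL (D : Matrix (Fin m) (Fin m) F) (M : Matrix (Idx r m) (Idx r m) F)
    (y : Idx r m) : (embedW r D * M) iL y = M iL y := by
  simp [Matrix.mul_apply, Fintype.sum_sum_type, embedW_apply]

lemma embedW_mul_iD (D : Matrix (Fin m) (Fin m) F) (M : Matrix (Idx r m) (Idx r m) F) (i : Fin r)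
    (y : Idx r m) : (embedW r D * M) (iD i) y = M (iD i) y := by
  simp [Matrix.mul_apply, Fintype.sum_sum_type, embedW_apply, Matrix.one_apply]

lemma mul_embedW_iE (D : Matrix (Fin m) (Fin m) F) (M : Matrix (Idx r m) (Idx r m) F) (i : Fin r)
    (x : Idx r m) : (M * embedW r D) x (iE i) = M x (iE i) := by
  simp [Matrix.mul_apply, Fintype.sum_sum_type, embedW_apply, Matrix.one_apply]

lemma mul_embedW_iL (D : Matrix (Fin m) (Fin m) F) (M : Matrix (Idx r m) (Idx r m) F)
    (x : Idx r m) : (M * embedW r D) x iL = M x iL := by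
  simp [Matrix.mul_apply, Fintype.sum_sum_type, embedW_apply]

lemma mul_embedW_nextE (D : Matrix (Fin m) (Fin m) F) (M : Matrix (Idx r m) (Idx r m) F)
    (i : Fin r) (x : Idx r m) : (M * embedW r D) x (nextE i) = M x (nextE i) := by
  unfold nextE
  split_ifs
  · exact mul_embedW_iE D M _ x
  · exact mul_embedW_iL D M x

lemma embedW_mul_prevD (D : Matrix (Fin m) (Fin m) F) (M : Matrix (Idx r m) (Idx r m) F)
    (i : Fin r) (y : Idx r m) : (embedW r D * M) (prevD i) y = M (prevD i) y := by
  unfold prevD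
  split_ifs
  · exact embedW_mul_iD D M _ y
  · exact embedW_mul_iL D M y

lemma embedW_map (σ : F →+* F) (D : Matrix (Fin m) (Fin m) F) :
    (embedW r D).map σ = embedW r (D.map σ) := by
  simp [embedW_apply, fromBlocks_map, Matrix.map_one]

lemma embedW_mem_besselMonoid' {D : Matrix (Fin m) (Fin m) F}
    (hD : ∀ a b, D a b ∈ (algebraMap F₀ F).range) : embedW r D ∈ besselMonoid' F₀ F r m := by
  refine ⟨?_, by simp [embedW_apply], by simp [embedW_apply], by simp [embedW_apply],
    by simp [embedW_apply], by simp [embedW_apply], hD⟩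
  rintro (i | (_ | a) | i) (j | (_ | b) | j) h <;>
    first
    | rfl
    | exact absurd h (lt_irrefl _)
    | (simp only [embedW_apply, fromBlocks_apply₁₁, fromBlocks_apply₂₂]
       exact Matrix.one_apply_ne (by rintro rfl; exact lt_irrefl _ h))

lemma embedGL_mem_boldH' {D : GL (Fin m) F}
    (hD : ∀ a b, (D : Matrix (Fin m) (Fin m) F) a b ∈ (algebraMap F₀ F).range)
    (hD' : ∀ a b, ((D⁻¹ : GL (Fin m) F) : Matrix (Fin m) (Fin m) F) a b
      ∈ (algebraMap F₀ F).range) : embedGL F r m D ∈ boldH' F₀ F r m :=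
  (Submonoid.mem_units_iff _ _).2 ⟨embedW_mem_besselMonoid' hD, embedW_mem_besselMonoid' hD'⟩

lemma embedGL_mem_boldH'_self (D : GL (Fin m) F) : embedGL F r m D ∈ boldH' F F r m :=
  embedGL_mem_boldH' (fun _ _ => ⟨_, rfl⟩) (fun _ _ => ⟨_, rfl⟩)

lemma boldH'_le_self : boldH' F₀ F r m ≤ boldH' F F r m := by
  intro h hh
  obtain ⟨h1, h2⟩ := (Submonoid.mem_units_iff _ _).1 hh
  exact (Submonoid.mem_units_iff _ _).2
    ⟨⟨h1.1, h1.2.1, h1.2.2.1, h1.2.2.2.1, h1.2.2.2.2.1, h1.2.2.2.2.2.1, fun _ _ => ⟨_, rfl⟩⟩,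
      ⟨h2.1, h2.2.1, h2.2.2.1, h2.2.2.2.1, h2.2.2.2.2.1, h2.2.2.2.2.2.1, fun _ _ => ⟨_, rfl⟩⟩⟩

lemma wBlock_mul_of_mem {A B : Matrix (Idx r m) (Idx r m) F} (hA : A ∈ besselMonoid' F₀ F r m)
    (hB : B ∈ besselMonoid' F₀ F r m) : wBlock (A * B) = wBlock A * wBlock B := by
  ext a b
  simp only [wBlock, Matrix.of_apply, Matrix.mul_apply, Fintype.sum_sum_type]
  have h1 : ∀ i : Fin r, A (iW a) (iE i) = 0 := fun i => hA.1 _ _ (by simp [height])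
  have h2 : ∀ i : Fin r, B (iD i) (iW b) = 0 := fun i =>
    hB.1 _ _ (by simp only [height]; omega)
  simp [h1, h2, hA.2.2.2.2.2.1]

/-- The action on `W`, as a homomorphism to `GL(W)`. -/
def wUnit (F₀ F : Type*) [NormedField F₀] [NormedField F] [NormedAlgebra F₀ F] (r m : ℕ) :
    boldH' F₀ F r m →* GL (Fin m) F where
  toFun h :=
    { val := wBlock (h.1 : Matrix (Idx r m) (Idx r m) F)
      inv := wBlock ((h.1⁻¹ : GL (Idx r m) F) : Matrix (Idx r m) (Idx r m) F)
      val_inv := by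
        obtain ⟨h1, h2⟩ := (Submonoid.mem_units_iff _ _).1 h.2
        rw [← wBlock_mul_of_mem h1 h2, ← Units.val_mul, mul_inv_cancel, Units.val_one,
          ← map_one (embedW (F := F) (m := m) r), wBlock_embedW]
      inv_val := by
        obtain ⟨h1, h2⟩ := (Submonoid.mem_units_iff _ _).1 h.2
        rw [← wBlock_mul_of_mem h2 h1, ← Units.val_mul, inv_mul_cancel, Units.val_one,
          ← map_one (embedW (F := F) (m := m) r), wBlock_embedW] }
  map_one' := Units.ext (by
    change wBlock (1 : Matrix (Idx r m) (Idx r m) F) = 1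
    rw [← map_one (embedW (F := F) (m := m) r), wBlock_embedW])
  map_mul' g h := Units.ext
    (wBlock_mul_of_mem ((Submonoid.mem_units_iff _ _).1 g.2).1
      ((Submonoid.mem_units_iff _ _).1 h.2).1)

lemma coe_wUnit (h : boldH' F₀ F r m) :
    (wUnit F₀ F r m h : Matrix (Fin m) (Fin m) F)
      = wBlock (h.1 : Matrix (Idx r m) (Idx r m) F) := rfl

variable [IsUltrametricDist F]

/-- An integral product `L S U`, with `L` and `U` unitriangular and `S` diagonal with unit entries,
has integral factors.  The factors may have extra rows, respectively columns: `a` and `b` pick out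
the square parts. -/
lemma integral_of_lower_mul_diagonal_mul_upper {α β : Type*} (L : Matrix α (Fin r) F)
    (U : Matrix (Fin r) β F) (a : Fin r → α) (b : Fin r → β) (s : Fin r → F)
    (hL : ∀ i j, i < j → L (a i) j = 0) (hL1 : ∀ i, L (a i) i = 1)
    (hU : ∀ i j, j < i → U i (b j) = 0) (hU1 : ∀ i, U i (b i) = 1) (hs : ∀ i, ‖s i‖ = 1)
    (hrow : ∀ k y, ‖∑ i, L (a k) i * s i * U i y‖ ≤ 1)
    (hcol : ∀ x k, ‖∑ i, L x i * s i * U i (b k)‖ ≤ 1) :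
    ∀ k, (∀ y, ‖U k y‖ ≤ 1) ∧ ∀ x, ‖L x k‖ ≤ 1 := by
  intro k
  induction k using WellFoundedLT.induction with
  | _ k ih =>
    have hsum : ∀ f : Fin r → F, (∀ i, k < i → f i = 0) → (∀ i, i < k → ‖f i‖ ≤ 1) →
        ‖∑ i, f i‖ ≤ 1 → ‖f k‖ ≤ 1 := by
      intro f h0 h1 hf
      have e : f k = ∑ i, f i - ∑ i ∈ Finset.univ.erase k, f i := by
        rw [← Finset.add_sum_erase _ f (Finset.mem_univ k)]; ring
      rw [e, sub_eq_add_neg]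
      refine (IsUltrametricDist.norm_add_le_max _ _).trans (max_le hf ?_)
      rw [norm_neg]
      refine IsUltrametricDist.norm_sum_le_of_forall_le_of_nonneg zero_le_one fun i hi => ?_
      rcases lt_or_gt_of_ne (Finset.ne_of_mem_erase hi) with h | h
      · exact h1 i h
      · rw [h0 i h, norm_zero]; exact zero_le_one
    refine ⟨fun y => ?_, fun x => ?_⟩
    · have := hsum (fun i => L (a k) i * s i * U i y) (fun i hi => by simp [hL k i hi])
        (fun i hi => by
          rw [norm_mul, norm_mul, hs, mul_one]
          exact mul_le_one₀ ((ih i hi).2 _) (norm_nonneg _) ((ih i hi).1 y)) (hrow k y)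
      simpa [hL1, hs] using this
    · have := hsum (fun i => L x i * s i * U i (b k)) (fun i hi => by simp [hU i k hi])
        (fun i hi => by
          rw [norm_mul, norm_mul, hs, mul_one]
          exact mul_le_one₀ ((ih i hi).2 _) (norm_nonneg _) ((ih i hi).1 _)) (hcol x k)
      simpa [hU1, hs] using this

/-- If `n₁⁻¹ (t, A) n₂` is integral for a normal form with unit invariants and `n₁`, `n₂` of
parabolic shape, then the first `r` rows of `n₂` and the last `r` columns of `n₁⁻¹` are integral:
the lower left corner of the product is a triangular factorisation. -/
lemma integral_rows_and_columns (σ : F ≃ₐ[F₀] F) (hiso : ∀ x, ‖σ x‖ = ‖x‖) {t : Fin r → F}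
    (ht : ∀ i, ‖t i‖ = 1) (A : Matrix (SharpIdx m) (SharpIdx m) F) {n₁ n₂ : GL (Idx r m) F}
    (h₁ : n₁ ∈ boldH' F F r m) (h₂ : n₂ ∈ boldH' F F r m)
    (hM : ∀ x y, ‖(((n₁⁻¹ : GL (Idx r m) F) : Matrix (Idx r m) (Idx r m) F) * normalForm σ t A *
      (n₂ : Matrix (Idx r m) (Idx r m) F)) x y‖ ≤ 1) :
    (∀ k y, ‖(n₂ : Matrix (Idx r m) (Idx r m) F) (iE k) y‖ ≤ 1) ∧
    ∀ x k, ‖((n₁⁻¹ : GL (Idx r m) F) : Matrix (Idx r m) (Idx r m) F) x (iD k)‖ ≤ 1 := by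
  set N₁ := ((n₁⁻¹ : GL (Idx r m) F) : Matrix (Idx r m) (Idx r m) F)
  set N₂ := (n₂ : Matrix (Idx r m) (Idx r m) F)
  have b₁ : N₁ ∈ besselMonoid' F F r m := ((Submonoid.mem_units_iff _ _).1 h₁).2
  have b₂ : N₂ ∈ besselMonoid' F F r m := ((Submonoid.mem_units_iff _ _).1 h₂).1
  have hrow : ∀ k y, (N₁ * normalForm σ t A * N₂) (iD k) y
      = ∑ i, N₁ (iD k) (iD i) * (σ (t i))⁻¹ * N₂ (iE i) y := by
    intro k y
    have h1 : ∀ i, N₁ (iD k) (iE i) = 0 := fun i => b₁.1 _ _ (by simp only [height]; omega)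
    have h2 : ∀ s : SharpIdx m, N₁ (iD k) (Sum.inr (Sum.inl s)) = 0 := fun s =>
      b₁.1 _ _ (by simp only [height]; omega)
    simp [Matrix.mul_apply, Fintype.sum_sum_type, normalForm, h1, h2]
  have hcol : ∀ x k, (N₁ * normalForm σ t A * N₂) x (iE k)
      = ∑ i, N₁ x (iD i) * (σ (t i))⁻¹ * N₂ (iE i) (iE k) := by
    intro x k
    have h1 : ∀ i, N₂ (iD i) (iE k) = 0 := fun i => b₂.1 _ _ (by simp only [height]; omega)
    have h2 : ∀ s : SharpIdx m, N₂ (Sum.inr (Sum.inl s)) (iE k) = 0 := fun s =>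
      b₂.1 _ _ (by simp only [height]; omega)
    simp only [Sum.forall] at h2
    simp [Matrix.mul_apply, Fintype.sum_sum_type, normalForm, h1, h2.1, h2.2]
  have key := integral_of_lower_mul_diagonal_mul_upper
    (Matrix.of fun x i => N₁ x (iD i)) (Matrix.of fun i y => N₂ (iE i) y) iD iE
    (fun i => (σ (t i))⁻¹)
    (fun i j hij => b₁.1 _ _ (by simp only [height]; omega)) (fun i => b₁.2.2.1 i)
    (fun i j hij => b₂.1 _ _ hij) (fun i => b₂.2.1 i)
    (fun i => by rw [norm_inv, hiso, ht, inv_one])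
    (fun k y => by simpa only [Matrix.of_apply, hrow] using hM (iD k) y)
    (fun x k => by simpa only [Matrix.of_apply, hcol] using hM x (iE k))
  exact ⟨fun k y => (key k).1 y, fun x k => (key k).2 x⟩

/-- A matrix of parabolic shape acting trivially on `W` is integral as soon as its first `r` rows
and the last `r` columns of its inverse are. -/
lemma isIntegralMatrix_of_rows_and_columns {n : GL (Idx r m) F} (hn : n ∈ boldH' F F r m)
    (hW : wBlock (n : Matrix (Idx r m) (Idx r m) F) = 1)
    (hrow : ∀ k y, ‖(n : Matrix (Idx r m) (Idx r m) F) (iE k) y‖ ≤ 1)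
    (hcol : ∀ x k, ‖((n⁻¹ : GL (Idx r m) F) : Matrix (Idx r m) (Idx r m) F) x (iD k)‖ ≤ 1) :
    IsIntegralMatrix (n : Matrix (Idx r m) (Idx r m) F) := by
  obtain ⟨b, b'⟩ := (Submonoid.mem_units_iff _ _).1 hn
  have hmul : (n : Matrix (Idx r m) (Idx r m) F) * (n⁻¹ : GL (Idx r m) F).val = 1 := by
    rw [← Units.val_mul, mul_inv_cancel, Units.val_one]
  set N := (n : Matrix (Idx r m) (Idx r m) F)
  set N' := ((n⁻¹ : GL (Idx r m) F) : Matrix (Idx r m) (Idx r m) F)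
  let U : Matrix (Fin r) (Fin r) F := Matrix.of fun i j => N (iE i) (iE j)
  let X : Matrix (Fin r) (SharpIdx m ⊕ Fin r) F := Matrix.of fun i y => N (iE i) (Sum.inr y)
  let Z : Matrix (SharpIdx m) (Fin r) F := Matrix.of fun s j => N (Sum.inr (Sum.inl s)) (iD j)
  let T : Matrix (Fin r) (Fin r) F := Matrix.of fun i j => N (iD i) (iD j)
  let Z' : Matrix (SharpIdx m) (Fin r) F := Matrix.of fun s j => N' (Sum.inr (Sum.inl s)) (iD j)
  let T' : Matrix (Fin r) (Fin r) F := Matrix.of fun i j => N' (iD i) (iD j)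
  have hES : ∀ (s : SharpIdx m) i, N (Sum.inr (Sum.inl s)) (iE i) = 0 := fun s i =>
    b.1 _ _ (by simp only [height]; omega)
  have hED : ∀ i j, N (iD i) (iE j) = 0 := fun i j => b.1 _ _ (by simp only [height]; omega)
  have hSD : ∀ i (s : SharpIdx m), N (iD i) (Sum.inr (Sum.inl s)) = 0 := fun i s =>
    b.1 _ _ (by simp only [height]; omega)
  have hSS : ∀ s s' : SharpIdx m, N (Sum.inr (Sum.inl s)) (Sum.inr (Sum.inl s'))
      = (1 : Matrix _ _ F) s s' := by
    rintro (_ | a) (_ | b')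
    · simpa using b.2.2.2.1
    · simpa using b.2.2.2.2.1 b'
    · simpa using b.2.2.2.2.2.1 a
    · have := congrFun (congrFun hW a) b'
      simp only [wBlock, Matrix.of_apply] at this
      rw [this]
      simp [Matrix.one_apply]
  have hN : N = fromBlocks U X 0 (fromBlocks 1 Z 0 T) := by
    ext (i | s | i) (j | s' | j)
    · rfl
    · rfl
    · rfl
    · exact hES s j
    · exact hSS s s'
    · rfl
    · exact hED i j
    · exact hSD i s'
    · rfl
  have hTT : T * T' = 1 := by
    ext i j
    have := congrFun (congrFun hmul (iD i)) (iD j)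
    rw [Matrix.mul_apply, Fintype.sum_sum_type, Fintype.sum_sum_type] at this
    simp only [hED, hSD, zero_mul, Finset.sum_const_zero, zero_add] at this
    rw [Matrix.mul_apply]
    refine this.trans ?_
    simp [Matrix.one_apply]
  have hZT : Z * T' = -Z' := by
    ext s j
    have := congrFun (congrFun hmul (Sum.inr (Sum.inl s))) (iD j)
    rw [Matrix.mul_apply, Fintype.sum_sum_type, Fintype.sum_sum_type] at this
    simp only [hES, hSS, zero_mul, Finset.sum_const_zero, zero_add, Matrix.one_apply, ite_mul,
      one_mul, Finset.sum_ite_eq, Finset.mem_univ, if_true, reduceCtorEq, if_false,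
      Sum.inr.injEq] at this
    rw [Matrix.mul_apply, Matrix.neg_apply, eq_neg_iff_add_eq_zero, add_comm]
    exact this
  have hT'det : T'.det = 1 := by
    rw [Matrix.det_of_isLowerTriangular T' fun i j hij => b'.1 _ _ (by
      have : i < j := hij
      simp only [height]; omega)]
    exact Finset.prod_eq_one fun i _ => b'.2.2.1 i
  have hT' : IsIntegralMatrix T' := ⟨fun i j => hcol _ _, by rw [hT'det, norm_one]⟩
  have hT : IsIntegralMatrix T := hT'.of_mul_eq_one (mul_eq_one_comm.1 hTT)
  have hZ : ∀ s j, ‖Z s j‖ ≤ 1 := by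
    intro s j
    have e : Z = -Z' * T := by
      rw [← hZT, Matrix.mul_assoc, mul_eq_one_comm.1 hTT, Matrix.mul_one]
    rw [e]
    exact norm_mul_apply_le_one (fun k => by rw [Matrix.neg_apply, norm_neg]; exact hcol _ _)
      fun k => hT.1 k j
  have hUdet : U.det = 1 := by
    rw [Matrix.det_of_isUpperTriangular (M := U) fun i j hij => b.1 _ _ hij]
    exact Finset.prod_eq_one fun i _ => b.2.1 i
  refine ⟨?_, ?_⟩
  · rintro (i | s | i) y
    · exact hrow i y
    · rw [hN]
      rcases y with j | s' | j
      · simp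
      · simpa using isIntegralMatrix_one.1 s s'
      · exact hZ s j
    · rw [hN]
      rcases y with j | s' | j
      · simp
      · simp
      · exact hT.1 i j
  · rw [hN, det_fromBlocks_zero₂₁, det_fromBlocks_zero₂₁, hUdet, det_one, one_mul, one_mul, hT.2]

end Parabolic

/-! ### The middle block of a normal form -/

section NormalForm

variable {F₀ F : Type*} [NormedField F₀] [NormedField F] [NormedAlgebra F₀ F]
variable {r m : ℕ}

lemma embedW_mul_normalForm_mul_embedW (σ : F ≃ₐ[F₀] F) (t : Fin r → F)
    (A : Matrix (SharpIdx m) (SharpIdx m) F) (D D' : Matrix (Fin m) (Fin m) F) :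
    embedW r D * normalForm σ t A * embedW r D'
      = normalForm σ t (fromBlocks 1 0 0 D * A * fromBlocks 1 0 0 D') := by
  have h : ∀ B : Matrix (SharpIdx m) (SharpIdx m) F, normalForm σ t B
      = fromBlocks 0 (fromCols 0 (diagonal t))
        (fromRows 0 (diagonal fun i => (σ (t i))⁻¹)) (fromBlocks B 0 0 0) := by
    intro B
    ext (i | s | i) (j | s' | j) <;> simp [normalForm, diagonal_apply]
  rw [h, h, embedW_apply, embedW_apply]
  ext (i | s | i) (j | s' | j) <;>
    simp [fromBlocks_multiply, fromCols_mul_fromBlocks, fromBlocks_mul_fromRows]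

lemma norm_normalForm_apply_le_one_iff {σ : F ≃ₐ[F₀] F} (hiso : ∀ x, ‖σ x‖ = ‖x‖) {t : Fin r → F}
    (ht : ∀ i, ‖t i‖ = 1) (A : Matrix (SharpIdx m) (SharpIdx m) F) :
    (∀ x y, ‖normalForm σ t A x y‖ ≤ 1) ↔ ∀ x y, ‖A x y‖ ≤ 1 := by
  refine ⟨fun h x y => h (Sum.inr (Sum.inl x)) (Sum.inr (Sum.inl y)), fun h => ?_⟩
  rintro (i | s | i) (j | s' | j) <;> simp only [normalForm, Matrix.of_apply, norm_zero, zero_le_one]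
  · split_ifs
    · rw [ht]
    · simp
  · exact h s s'
  · split_ifs
    · rw [norm_inv, hiso, ht, inv_one]
    · simp

lemma isIntegralMatrix_embedW_iff [IsUltrametricDist F] {D : Matrix (Fin m) (Fin m) F} :
    IsIntegralMatrix (embedW r D) ↔ IsIntegralMatrix D := by
  have hdet : (embedW r D).det = D.det := by
    simp [embedW_apply]
  rw [IsIntegralMatrix, IsIntegralMatrix, hdet]
  refine and_congr_left fun _ => ⟨fun h a b => h (iW a) (iW b), fun h => ?_⟩
  rintro (i | (_ | a) | i) (j | (_ | b) | j) <;>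
    simp only [embedW_apply, fromBlocks_apply₁₁, fromBlocks_apply₂₂, fromBlocks_apply₁₂,
      fromBlocks_apply₂₁, Matrix.zero_apply, norm_zero, zero_le_one]
  · exact isIntegralMatrix_one.1 i j
  · exact isIntegralMatrix_one.1 _ _
  · exact h a b
  · exact isIntegralMatrix_one.1 i j

lemma eq_embedGL_wUnit (h : boldH' F F 0 m) : h.1 = embedGL F 0 m (wUnit F F 0 m h) := by
  have b := ((Submonoid.mem_units_iff _ _).1 h.2).1
  refine Units.ext ?_
  ext (i | (_ | a) | i) (j | (_ | b') | j)
  all_goals first | exact Fin.elim0 ‹Fin 0› | skip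
  · exact b.2.2.2.1
  · exact b.2.2.2.2.1 b'
  · exact b.2.2.2.2.2.1 a
  · rfl

lemma inv_mul_inv_mul_conj {ι : Type*} [Fintype ι] [DecidableEq ι] (a b e : GL ι F)
    (g : Matrix ι ι F) :
    (((e⁻¹ * a)⁻¹ : GL ι F) : Matrix ι ι F) * (((e⁻¹ : GL ι F) : Matrix ι ι F) * g * e.val) *
      (e⁻¹ * b).val = (a⁻¹).val * g * b.val := by
  have h1 : e.val * (e⁻¹).val = 1 := by rw [← Units.val_mul, mul_inv_cancel, Units.val_one]
  rw [_root_.mul_inv_rev, inv_inv, Units.val_mul, Units.val_mul]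
  simp only [Matrix.mul_assoc]
  rw [← Matrix.mul_assoc e.val, h1, Matrix.one_mul, ← Matrix.mul_assoc e.val, h1, Matrix.one_mul]

variable [IsUltrametricDist F]

/-- For `h₁`, `h₂` of parabolic shape acting by the same `D` on `W`, integrality of `h₁⁻¹ g h₂`
for a normal form `g` with unit invariants bounds the unipotent parts `D⁻¹ hᵢ`. -/
lemma integral_rows_and_columns_of_wUnit_eq (σ : F ≃ₐ[F₀] F) (hiso : ∀ x, ‖σ x‖ = ‖x‖)
    {t : Fin r → F} (ht : ∀ i, ‖t i‖ = 1) (A : Matrix (SharpIdx m) (SharpIdx m) F)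
    {h₁ h₂ : GL (Idx r m) F} (hh₁ : h₁ ∈ boldH' F F r m) (hh₂ : h₂ ∈ boldH' F F r m)
    (D : GL (Fin m) F)
    (hM : ∀ x y, ‖(((h₁⁻¹ : GL (Idx r m) F) : Matrix (Idx r m) (Idx r m) F) * normalForm σ t A *
      (h₂ : Matrix (Idx r m) (Idx r m) F)) x y‖ ≤ 1) :
    (∀ k y, ‖(((embedGL F r m D)⁻¹ * h₂ : GL (Idx r m) F) :
        Matrix (Idx r m) (Idx r m) F) (iE k) y‖ ≤ 1) ∧
    ∀ x k, ‖((((embedGL F r m D)⁻¹ * h₁)⁻¹ : GL (Idx r m) F) :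
        Matrix (Idx r m) (Idx r m) F) x (iD k)‖ ≤ 1 := by
  have hD : (embedGL F r m D)⁻¹ ∈ boldH' F F r m := inv_mem (embedGL_mem_boldH'_self D)
  refine integral_rows_and_columns σ hiso ht
    (fromBlocks 1 0 0 ((D⁻¹ : GL (Fin m) F) : Matrix (Fin m) (Fin m) F) * A *
      fromBlocks 1 0 0 (D : Matrix (Fin m) (Fin m) F))
    (mul_mem hD hh₁) (mul_mem hD hh₂) ?_
  intro x y
  rw [← embedW_mul_normalForm_mul_embedW, ← coe_inv_embedGL, ← coe_embedGL, inv_mul_inv_mul_conj]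
  exact hM x y

end NormalForm

/-! ### Orbital integrals on the unitary group -/

section Unitary

variable {F₀ F : Type*} [NormedField F₀] [NormedField F] [NormedAlgebra F₀ F]
variable {r m : ℕ} {σ : F ≃ₐ[F₀] F} {c : F} {J : Matrix (Fin m) (Fin m) F}

lemma mem_besselH_iff {h : GL (Idx r m) F} : h ∈ besselH r σ c J ↔
    ((h : Matrix (Idx r m) (Idx r m) F) ∈ unitaryMonoid σ (gram c J) ∧
      (h : Matrix (Idx r m) (Idx r m) F) ∈ besselMonoid F r m) ∧
    (((h⁻¹ : GL (Idx r m) F) : Matrix (Idx r m) (Idx r m) F) ∈ unitaryMonoid σ (gram c J) ∧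
      ((h⁻¹ : GL (Idx r m) F) : Matrix (Idx r m) (Idx r m) F) ∈ besselMonoid F r m) :=
  Submonoid.mem_units_iff _ _

lemma gram_mul_inv_of_mem_unitaryMonoid {ι : Type*} [Fintype ι] [DecidableEq ι]
    {G : Matrix ι ι F} {h : GL ι F} (hh : (h : Matrix ι ι F) ∈ unitaryMonoid σ G) :
    G * ((h⁻¹ : GL ι F) : Matrix ι ι F) = ((h : Matrix ι ι F).map σ)ᵀ * G := by
  have hu : ((h : Matrix ι ι F).map σ)ᵀ * G * (h : Matrix ι ι F) = G := hh
  conv_lhs => rw [← hu]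
  rw [Matrix.mul_assoc _ (h : Matrix ι ι F), ← Units.val_mul, mul_inv_cancel, Units.val_one,
    Matrix.mul_one]

lemma besselH_iD_iD {h : GL (Idx r m) F} (hh : h ∈ besselH r σ c J) (i j : Fin r) :
    (h : Matrix (Idx r m) (Idx r m) F) (iD i) (iD j)
      = σ (((h⁻¹ : GL (Idx r m) F) : Matrix (Idx r m) (Idx r m) F) (iE j) (iE i)) := by
  have key := gram_mul_inv_of_mem_unitaryMonoid (mem_besselH_iff.1 (inv_mem hh)).1.1
  rw [inv_inv] at key
  have e := congrFun (congrFun key (iE i)) (iD j)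
  rw [Matrix.mul_apply, Matrix.mul_apply] at e
  simp only [Fintype.sum_sum_type, Matrix.transpose_apply, Matrix.map_apply, gram,
    Matrix.of_apply] at e
  simpa using e

lemma besselH_iL_iW (hc : c ≠ 0) {h : GL (Idx r m) F} (hh : h ∈ besselH r σ c J) (a : Fin m) :
    (h : Matrix (Idx r m) (Idx r m) F) iL (iW a) = 0 := by
  have hb := (mem_besselH_iff.1 (inv_mem hh)).1
  have key := gram_mul_inv_of_mem_unitaryMonoid hb.1
  rw [inv_inv] at key
  have e := congrFun (congrFun key iL) (iW a)
  rw [Matrix.mul_apply, Matrix.mul_apply] at e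
  simp only [Fintype.sum_sum_type, Matrix.transpose_apply, Matrix.map_apply, gram,
    Matrix.of_apply, hb.2.2] at e
  simpa [hc] using e

lemma besselH_le_boldH' (hc : c ≠ 0) : besselH r σ c J ≤ boldH' F F r m := by
  have key : ∀ h ∈ besselH r σ c J,
      (h : Matrix (Idx r m) (Idx r m) F) ∈ besselMonoid' F F r m := by
    intro h hh
    have hb := (mem_besselH_iff.1 hh).1.2
    have hb' := (mem_besselH_iff.1 hh).2.2
    refine ⟨?_, fun i => (hb.1 i).1, fun i => ?_, by simpa using hb.2 (Sum.inl (Sum.inl ())),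
      besselH_iL_iW hc hh, fun a => by simpa using hb.2 (Sum.inl (Sum.inr a)),
      fun _ _ => ⟨_, rfl⟩⟩
    · rintro (i | s | i) (j | (_ | a) | j) hxy
      · exact (hb.1 j).2.1 i hxy
      · simp only [height] at hxy; omega
      · simp only [height] at hxy; omega
      · simp only [height] at hxy; omega
      · exact (hb.1 j).2.2 _
      · simp only [height] at hxy; omega
      · simp only [height] at hxy; omega
      · simp only [height] at hxy; omega
      · exact (hb.1 j).2.2 _
      · simpa using hb.2 (Sum.inr i)
      · exact besselH_perp hh i a
      · have hij : i < j := by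
          simp only [height] at hxy
          exact Fin.lt_def.2 (by omega)
        rw [besselH_iD_iD hh, (hb'.1 i).2.1 j hij, map_zero]
    · rw [besselH_iD_iD hh, (hb'.1 i).1, map_one]
  exact fun h hh => (Submonoid.mem_units_iff _ _).2 ⟨key h hh, key h⁻¹ (inv_mem hh)⟩

lemma wBlock_mem_unitaryMonoid (hc : c ≠ 0) {h : GL (Idx r m) F} (hh : h ∈ besselH r σ c J) :
    wBlock (h : Matrix (Idx r m) (Idx r m) F) ∈ unitaryMonoid σ J := by
  have hu : ((h : Matrix (Idx r m) (Idx r m) F).map σ)ᵀ * gram c J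
    * (h : Matrix (Idx r m) (Idx r m) F) = gram c J := (mem_besselH_iff.1 hh).1.1
  change ((wBlock (h : Matrix (Idx r m) (Idx r m) F)).map σ)ᵀ * J * wBlock _ = J
  ext a b
  have e := congrFun (congrFun hu (iW a)) (iW b)
  simp only [Matrix.mul_apply, Fintype.sum_sum_type, Matrix.transpose_apply, Matrix.map_apply, gram,
    Matrix.of_apply, besselH_perp hh, besselH_iL_iW hc hh] at e
  simpa [Matrix.mul_apply, wBlock] using e

lemma embedW_mem_unitaryMonoid {D : Matrix (Fin m) (Fin m) F} (hD : D ∈ unitaryMonoid σ J) :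
    embedW r D ∈ unitaryMonoid σ (gram c J) := by
  have hD' : (D.map σ)ᵀ * J * D = J := hD
  change ((embedW r D).map (σ : F →+* F))ᵀ * gram c J * embedW r D = gram c J
  have hg : gram (r := r) c J = fromBlocks 0 (fromCols 0 1) (fromRows 0 1)
      (fromBlocks (fromBlocks (Matrix.of fun _ _ => c) 0 0 J) 0 0 0) := by
    ext (i | (_ | a) | i) (j | (_ | b) | j) <;> simp [gram, Matrix.one_apply]
  have hD'' : (D.map (σ : F →+* F))ᵀ * J * D = J := hD
  rw [embedW_map, hg, embedW_apply, embedW_apply]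
  ext (i | (_ | a) | i) (j | (_ | b) | j) <;>
    simp [fromBlocks_multiply, fromBlocks_transpose, fromCols_mul_fromBlocks,
      fromBlocks_mul_fromRows, hD', Matrix.one_apply]

lemma embedW_mem_besselMonoid (D : Matrix (Fin m) (Fin m) F) :
    embedW r D ∈ besselMonoid F r m := by
  refine ⟨fun j => ⟨by simp [embedW_apply], fun i hij => ?_, fun x => rfl⟩, ?_⟩
  · simp [embedW_apply, hij.ne']
  · rintro ((_ | a) | i) <;> simp [embedW_apply]

lemma embedGL_mem_besselH {D : GL (Fin m) F}
    (hD : (D : Matrix (Fin m) (Fin m) F) ∈ unitaryMonoid σ J)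
    (hD' : ((D⁻¹ : GL (Fin m) F) : Matrix (Fin m) (Fin m) F) ∈ unitaryMonoid σ J) :
    embedGL F r m D ∈ besselH r σ c J :=
  mem_besselH_iff.2 ⟨⟨embedW_mem_unitaryMonoid hD, embedW_mem_besselMonoid _⟩,
    ⟨embedW_mem_unitaryMonoid hD', embedW_mem_besselMonoid _⟩⟩

lemma embedGL_mem_boldH {D : GL (Fin m) F}
    (hD : (D : Matrix (Fin m) (Fin m) F) ∈ unitaryMonoid σ J)
    (hD' : ((D⁻¹ : GL (Fin m) F) : Matrix (Fin m) (Fin m) F) ∈ unitaryMonoid σ J) :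
    (embedGL F r m D, embedGL F r m D) ∈ boldH r σ c J :=
  ⟨embedGL_mem_besselH hD hD', embedGL_mem_besselH hD hD', rfl⟩

/-- The action on `W` of an element of `𝐇(F₀)`. -/
def boldHToGL (r : ℕ) {m : ℕ} (σ : F ≃ₐ[F₀] F) {c : F} (hc : c ≠ 0)
    (J : Matrix (Fin m) (Fin m) F) : boldH r σ c J →* GL (Fin m) F where
  toFun h := wUnit F F r m ⟨h.1.1, besselH_le_boldH' hc h.2.1⟩
  map_one' := map_one (wUnit F F r m)
  map_mul' g h := map_mul (wUnit F F r m) ⟨g.1.1, besselH_le_boldH' hc g.2.1⟩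
    ⟨h.1.1, besselH_le_boldH' hc h.2.1⟩

lemma boldHToGL_mem (hc : c ≠ 0) (h : boldH r σ c J) :
    (boldHToGL r σ hc J h : Matrix (Fin m) (Fin m) F) ∈ unitaryMonoid σ J :=
  wBlock_mem_unitaryMonoid hc h.2.1

lemma boldHToGL_inv_mem (hc : c ≠ 0) (h : boldH r σ c J) :
    (((boldHToGL r σ hc J h)⁻¹ : GL (Fin m) F) : Matrix (Fin m) (Fin m) F) ∈ unitaryMonoid σ J :=
  wBlock_mem_unitaryMonoid hc (inv_mem h.2.1)

/-- The embedding of `U(W)`, in the guise of `𝐇(F₀)` for `r = 0`, in `𝐇(F₀)`. -/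
def boldHEmbed (r : ℕ) {m : ℕ} (σ : F ≃ₐ[F₀] F) {c : F} (hc : c ≠ 0)
    (J : Matrix (Fin m) (Fin m) F) : boldH 0 σ c J →* boldH r σ c J where
  toFun h := ⟨(embedGL F r m (boldHToGL 0 σ hc J h), embedGL F r m (boldHToGL 0 σ hc J h)),
    embedGL_mem_boldH (boldHToGL_mem hc h) (boldHToGL_inv_mem hc h)⟩
  map_one' := by simp only [map_one]; rfl
  map_mul' g h := by simp only [map_mul]; rfl

lemma boldH_zero_eq (hc : c ≠ 0) (h : boldH 0 σ c J) :
    h.1 = (embedGL F 0 m (boldHToGL 0 σ hc J h), embedGL F 0 m (boldHToGL 0 σ hc J h)) := by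
  refine Prod.ext (eq_embedGL_wUnit ⟨h.1.1, besselH_le_boldH' hc h.2.1⟩) ?_
  refine (eq_embedGL_wUnit ⟨h.1.2, besselH_le_boldH' hc h.2.2.1⟩).trans ?_
  congr 1
  exact Units.ext h.2.2.2.symm

variable [IsUltrametricDist F]

/-- The integral points of `𝐇` as a subgroup. -/
def boldHIntSubgroup (r : ℕ) {m : ℕ} (σ : F ≃ₐ[F₀] F) (c : F) (J : Matrix (Fin m) (Fin m) F) :
    Subgroup (boldH r σ c J) :=
  ((integralGL (Idx r m) F).prod (integralGL (Idx r m) F)).subgroupOf (boldH r σ c J)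

lemma isOpen_boldHIntSubgroup : IsOpen (boldHIntSubgroup r σ c J : Set (boldH r σ c J)) :=
  ((isOpen_integralGL (ι := Idx r m) (F := F)).prod
    (isOpen_integralGL (ι := Idx r m) (F := F))).preimage continuous_subtype_val

lemma comap_boldHEmbed (hc : c ≠ 0) :
    (boldHIntSubgroup r σ c J).comap (boldHEmbed r σ hc J) = boldHIntSubgroup 0 σ c J := by
  have key : ∀ D : GL (Fin m) F, embedGL F r m D ∈ integralGL (Idx r m) F ↔
      embedGL F 0 m D ∈ integralGL (Idx 0 m) F := fun D =>
    isIntegralMatrix_embedW_iff.trans isIntegralMatrix_embedW_iff.symm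
  ext h
  change (embedGL F r m _ ∈ integralGL (Idx r m) F ∧ embedGL F r m _ ∈ integralGL (Idx r m) F) ↔
    (h.1.1 ∈ integralGL (Idx 0 m) F ∧ h.1.2 ∈ integralGL (Idx 0 m) F)
  rw [boldH_zero_eq hc h, key]

lemma isIntegralMatrix_gram (hc1 : ‖c‖ = 1) (hJ : IsIntegralMatrix J) :
    IsIntegralMatrix (gram (r := r) c J) := by
  have hc : c ≠ 0 := norm_ne_zero_iff.1 (by rw [hc1]; exact one_ne_zero)
  have hent : ∀ (c : F) (J : Matrix (Fin m) (Fin m) F), ‖c‖ = 1 → (∀ a b, ‖J a b‖ ≤ 1) →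
      ∀ x y, ‖gram (r := r) c J x y‖ ≤ 1 := by
    rintro c J hc hJ (i | (_ | a) | i) (j | (_ | b) | j) <;>
      simp only [gram, Matrix.of_apply, norm_zero, zero_le_one]
    · split_ifs <;> simp
    · exact hc.le
    · exact hJ a b
    · split_ifs <;> simp
  have hJu : IsUnit J.det := isUnit_iff_ne_zero.2
    (norm_ne_zero_iff.1 (by rw [hJ.2]; exact one_ne_zero))
  have hJi : IsIntegralMatrix J⁻¹ := hJ.of_mul_eq_one (Matrix.mul_nonsing_inv _ hJu)
  refine isIntegralMatrix_of_mul_eq_one (hent c J hc1 hJ.1)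
    (hent c⁻¹ J⁻¹ (by rw [norm_inv, hc1, inv_one]) hJi.1) ?_
  have hJJ : ∀ a b, ∑ k, J a k * J⁻¹ k b = (1 : Matrix _ _ F) a b := fun a b => by
    rw [← Matrix.mul_apply, Matrix.mul_nonsing_inv _ hJu]
  ext (i | (_ | a) | i) (j | (_ | b) | j) <;>
    simp [Matrix.mul_apply, Fintype.sum_sum_type, gram, Matrix.one_apply, hc, hJJ]

omit [IsUltrametricDist F] in
lemma norm_det_eq_one_of_mem_unitaryMonoid (hiso : ∀ x, ‖σ x‖ = ‖x‖) {ι : Type*} [Fintype ι]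
    [DecidableEq ι] {G M : Matrix ι ι F} (hG : ‖G.det‖ = 1) (hM : M ∈ unitaryMonoid σ G) :
    ‖M.det‖ = 1 := by
  have h : (M.map (σ : F →+* F))ᵀ * G * M = G := hM
  have h1 := congrArg (fun X : Matrix ι ι F => ‖X.det‖) h
  simp only [Matrix.det_mul, Matrix.det_transpose, norm_mul, hG,
    norm_det_map (σ := (σ : F →+* F)) hiso, mul_one] at h1
  exact (mul_self_eq_one_iff.1 h1).resolve_right fun h2 => by
    have := norm_nonneg M.det
    rw [h2] at this
    norm_num at this

/-- For a unitary `n`, the rows of `n` at `E` are conjugate to the columns of `n⁻¹` at `E^∨`, up to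
the action of the Gram matrix. -/
lemma integral_rows_iff_columns (hiso : ∀ x, ‖σ x‖ = ‖x‖)
    (hG : IsIntegralMatrix (gram (r := r) c J)) {n : GL (Idx r m) F}
    (hn : (n : Matrix (Idx r m) (Idx r m) F) ∈ unitaryMonoid σ (gram c J)) :
    (∀ k y, ‖(n : Matrix (Idx r m) (Idx r m) F) (iE k) y‖ ≤ 1) ↔
    ∀ x k, ‖((n⁻¹ : GL (Idx r m) F) : Matrix (Idx r m) (Idx r m) F) x (iD k)‖ ≤ 1 := by
  have key := gram_mul_inv_of_mem_unitaryMonoid hn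
  have e : ∀ x k, (gram (r := r) c J *
      ((n⁻¹ : GL (Idx r m) F) : Matrix (Idx r m) (Idx r m) F)) x (iD k)
        = σ ((n : Matrix (Idx r m) (Idx r m) F) (iE k) x) := by
    intro x k
    rw [key, Matrix.mul_apply]
    simp [Fintype.sum_sum_type, gram]
  constructor
  · intro h x k
    have hu : IsUnit (gram (r := r) c J).det := isUnit_iff_ne_zero.2
      (norm_ne_zero_iff.1 (by rw [hG.2]; exact one_ne_zero))
    have hGi : IsIntegralMatrix (gram (r := r) c J)⁻¹ :=
      hG.of_mul_eq_one (Matrix.mul_nonsing_inv _ hu)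
    rw [← Matrix.nonsing_inv_mul_cancel_left (gram c J)
      ((n⁻¹ : GL (Idx r m) F) : Matrix (Idx r m) (Idx r m) F) hu]
    refine norm_mul_apply_le_one (hGi.1 x) fun y => ?_
    rw [e, hiso]
    exact h k y
  · intro h k y
    rw [← hiso, ← e]
    exact norm_mul_apply_le_one (hG.1 y) fun x => h x k

omit [IsUltrametricDist F] in
lemma testU_congr {r' : ℕ} {M : Matrix (Idx r m) (Idx r m) F} {M' : Matrix (Idx r' m) (Idx r' m) F}
    (hM : M ∈ unitaryMonoid σ (gram c J)) (hM' : M' ∈ unitaryMonoid σ (gram c J))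
    (h : IsSplitGram J → (IsIntegralMatrix M ↔ IsIntegralMatrix M')) :
    testU r σ c J M = testU r' σ c J M' := by
  classical
  unfold testU
  refine if_congr ?_ rfl rfl
  constructor
  · rintro ⟨h1, -, h2⟩; exact ⟨h1, hM', (h h1).1 h2⟩
  · rintro ⟨h1, -, h2⟩; exact ⟨h1, hM, (h h1).2 h2⟩

lemma isIntegralMatrix_inv_mul_mul_iff {ι : Type*} [Fintype ι] [DecidableEq ι] {k₁ k₂ : GL ι F}
    (hk₁ : IsIntegralMatrix (k₁ : Matrix ι ι F)) (hk₂ : IsIntegralMatrix (k₂ : Matrix ι ι F))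
    {X : Matrix ι ι F} :
    IsIntegralMatrix (((k₁⁻¹ : GL ι F) : Matrix ι ι F) * X * (k₂ : Matrix ι ι F)) ↔
      IsIntegralMatrix X := by
  refine ⟨fun h => ?_, fun h => (hk₁.inv.mul h).mul hk₂⟩
  have h' := (hk₁.mul h).mul hk₂.inv
  have e : (k₁ : Matrix ι ι F) * (((k₁⁻¹ : GL ι F) : Matrix ι ι F) * X * (k₂ : Matrix ι ι F)) *
      ((k₂⁻¹ : GL ι F) : Matrix ι ι F) = X := by
    have h1 : k₁.val * (k₁⁻¹).val = 1 := by rw [← Units.val_mul, mul_inv_cancel, Units.val_one]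
    have h2 : k₂.val * (k₂⁻¹).val = 1 := by rw [← Units.val_mul, mul_inv_cancel, Units.val_one]
    simp only [Matrix.mul_assoc]
    rw [h2, Matrix.mul_one, ← Matrix.mul_assoc, h1, Matrix.one_mul]
  rwa [e] at h'

lemma norm_lam_le_one {h : Matrix (Idx r m) (Idx r m) F}
    (hh : ∀ i, ‖h (iE i) (nextE i)‖ ≤ 1) : ‖lam h‖ ≤ 1 :=
  IsUltrametricDist.norm_sum_le_of_forall_le_of_nonneg zero_le_one fun i _ => hh i

lemma psiH_embedGL_mul_eq_one {ψ₀ : AddChar F₀ ℂ}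
    (hψ : ∀ x : F, ‖x‖ ≤ 1 → ψ₀ (Algebra.trace F₀ F x) = 1) (D : GL (Fin m) F)
    {k₁ k₂ : GL (Idx r m) F} (hk₁ : IsIntegralMatrix (k₁ : Matrix (Idx r m) (Idx r m) F))
    (hk₂ : IsIntegralMatrix (k₂ : Matrix (Idx r m) (Idx r m) F)) :
    psiH ψ₀ (embedGL F r m D * k₁, embedGL F r m D * k₂) = 1 := by
  unfold psiH
  rw [hψ, hψ, one_mul]
  · refine norm_lam_le_one fun i => ?_
    rw [Units.val_mul, coe_embedGL, embedW_mul_iE]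
    exact hk₂.1 _ _
  · refine norm_lam_le_one fun i => ?_
    rw [_root_.mul_inv_rev, Units.val_mul, coe_inv_embedGL, mul_embedW_nextE]
    exact hk₁.inv.1 _ _

/-- Reduction of the unitary orbital integral of a normal form with unit invariants to `r = 0`:
the integrand is supported on `U(W) · 𝐇(O_{F₀})`.  In the nonsplit case the test functions, and so
both integrals, vanish. -/
theorem orbU_normalForm_eq [SecondCountableTopology F] (hiso : ∀ x, ‖σ x‖ = ‖x‖)
    {ψ₀ : AddChar F₀ ℂ} (hψ : ∀ x : F, ‖x‖ ≤ 1 → ψ₀ (Algebra.trace F₀ F x) = 1) (hc1 : ‖c‖ = 1)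
    (μ : Measure (boldH r σ c J)) [μ.IsMulLeftInvariant] (hμ : μ (boldHInt r σ c J) = 1)
    (μs : Measure (boldH 0 σ c J)) [μs.IsMulLeftInvariant] (hμs : μs (boldHInt 0 σ c J) = 1)
    {t : Fin r → F} (ht : ∀ i, ‖t i‖ = 1) {A : Matrix (SharpIdx m) (SharpIdx m) F}
    (hg : normalForm σ t A ∈ unitaryMonoid σ (gram c J)) :
    orbU σ c J ψ₀ μ (normalForm σ t A) (testU r σ c J)
      = orbU σ c J ψ₀ μs (sharp σ A) (testU 0 σ c J) := by
  have hc : c ≠ 0 := norm_ne_zero_iff.1 (by rw [hc1]; exact one_ne_zero)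
  have := secondCountableTopology_GL (Idx r m) F
  have := secondCountableTopology_GL (Idx 0 m) F
  have : SecondCountableTopology (boldH r σ c J) :=
    Topology.IsEmbedding.subtypeVal.secondCountableTopology
  have : SecondCountableTopology (boldH 0 σ c J) :=
    Topology.IsEmbedding.subtypeVal.secondCountableTopology
  have hgs : sharp σ A ∈ unitaryMonoid σ (gram c J) := by
    have hg' : ((normalForm σ t A).map σ)ᵀ * gram c J * normalForm σ t A = gram c J := hg
    change ((sharp σ A).map σ)ᵀ * gram c J * sharp σ A = gram c J
    ext (i | s | i) (j | s' | j)
    all_goals first | exact Fin.elim0 ‹Fin 0› | skip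
    have e := congrFun (congrFun hg' (Sum.inr (Sum.inl s))) (Sum.inr (Sum.inl s'))
    rcases s with _ | a <;> rcases s' with _ | b <;>
    · simp only [Matrix.mul_apply, Fintype.sum_sum_type, Matrix.transpose_apply, Matrix.map_apply,
        gram, Matrix.of_apply, normalForm, sharp] at e ⊢
      simpa using e
  refine integral_eq_integral_comp_of_support μ μs (boldHIntSubgroup r σ c J)
    (boldHIntSubgroup 0 σ c J) isOpen_boldHIntSubgroup isOpen_boldHIntSubgroup hμ hμs
    (boldHEmbed r σ hc J) (comap_boldHEmbed hc) _ _ ?_ ?_ ?_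
  · intro d
    set D := boldHToGL 0 σ hc J d with hD
    have hDm := boldHToGL_mem hc d
    have hDi := boldHToGL_inv_mem hc d
    have e1 : (boldHEmbed r σ hc J d).1 = (embedGL F r m D, embedGL F r m D) := rfl
    rw [e1, boldH_zero_eq hc d, ← hD]
    have p1 := psiH_embedGL_mul_eq_one hψ D (r := r) (k₁ := 1) (k₂ := 1) isIntegralMatrix_one
      isIntegralMatrix_one
    have p2 := psiH_embedGL_mul_eq_one hψ D (r := 0) (k₁ := 1) (k₂ := 1) isIntegralMatrix_one
      isIntegralMatrix_one
    rw [mul_one] at p1 p2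
    rw [p1, p2, mul_one, mul_one]
    have u1 := mul_mem (mul_mem (embedW_mem_unitaryMonoid (r := r) (c := c) hDi) hg)
      (embedW_mem_unitaryMonoid hDm)
    have u2 := mul_mem (mul_mem (embedW_mem_unitaryMonoid (r := 0) (c := c) hDi) hgs)
      (embedW_mem_unitaryMonoid hDm)
    -- Determinants of unitary matrices are units, so only the entries of `D⁻¹AD` matter.
    refine testU_congr u1 u2 fun hJ => ?_
    have n1 := norm_det_eq_one_of_mem_unitaryMonoid hiso (isIntegralMatrix_gram hc1 hJ).2 u1
    have n2 := norm_det_eq_one_of_mem_unitaryMonoid hiso (isIntegralMatrix_gram hc1 hJ).2 u2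
    rw [embedW_mul_normalForm_mul_embedW] at n1
    rw [sharp, embedW_mul_normalForm_mul_embedW] at n2
    simp only [coe_inv_embedGL, coe_embedGL, sharp, embedW_mul_normalForm_mul_embedW]
    rw [IsIntegralMatrix, IsIntegralMatrix, norm_normalForm_apply_le_one_iff hiso ht,
      norm_normalForm_apply_le_one_iff hiso (fun i => i.elim0)]
    exact and_congr_right fun _ => by rw [n1, n2]
  · rintro d k ⟨hk1, hk2⟩
    change IsIntegralMatrix k.1.1.val at hk1
    change IsIntegralMatrix k.1.2.val at hk2
    set D := boldHToGL 0 σ hc J d with hD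
    have hDm := boldHToGL_mem hc d
    have hDi := boldHToGL_inv_mem hc d
    have e1 : (boldHEmbed r σ hc J d).1 = (embedGL F r m D, embedGL F r m D) := rfl
    have e2 : (boldHEmbed r σ hc J d * k).1
        = (embedGL F r m D * k.1.1, embedGL F r m D * k.1.2) := rfl
    rw [e1, e2, psiH_embedGL_mul_eq_one hψ D hk1 hk2]
    have p1 := psiH_embedGL_mul_eq_one hψ D (r := r) (k₁ := 1) (k₂ := 1) isIntegralMatrix_one
      isIntegralMatrix_one
    rw [mul_one] at p1
    rw [p1]
    congr 1
    have u1 := mul_mem (mul_mem (embedW_mem_unitaryMonoid (r := r) (c := c) hDi) hg)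
      (embedW_mem_unitaryMonoid hDm)
    have e3 : (((embedGL F r m D * k.1.1)⁻¹ : GL (Idx r m) F) : Matrix (Idx r m) (Idx r m) F) *
        normalForm σ t A * (embedGL F r m D * k.1.2 : GL (Idx r m) F).val
        = (k.1.1⁻¹).val * (((embedGL F r m D)⁻¹).val * normalForm σ t A *
          (embedGL F r m D).val) * k.1.2.val := by
      simp only [_root_.mul_inv_rev, Units.val_mul, Matrix.mul_assoc]
    rw [e3]
    refine testU_congr (mul_mem (mul_mem (mem_besselH_iff.1 k.2.1).2.1 u1)
      (mem_besselH_iff.1 k.2.2.1).1.1) u1 fun _ => isIntegralMatrix_inv_mul_mul_iff hk1 hk2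
  · intro h hh
    have hT := left_ne_zero_of_mul hh
    unfold testU at hT
    classical
    rw [ite_ne_right_iff] at hT
    obtain ⟨⟨hJ, -, hM⟩, -⟩ := hT
    set D := boldHToGL r σ hc J h with hD
    -- `h = ι(D) k`, and `k` is integral by the triangular factorisation and unitarity.
    let d : boldH 0 σ c J := ⟨(embedGL F 0 m D, embedGL F 0 m D),
      embedGL_mem_boldH (boldHToGL_mem hc h) (boldHToGL_inv_mem hc h)⟩
    have hd : boldHToGL 0 σ hc J d = D := Units.ext rfl
    have hdh : (boldHEmbed r σ hc J d).1 = (embedGL F r m D, embedGL F r m D) := by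
      rw [← hd]; rfl
    refine ⟨d, (boldHEmbed r σ hc J d)⁻¹ * h, ?_, by group⟩
    have hG := isIntegralMatrix_gram (r := r) hc1 hJ
    have hDm : (embedGL F r m D)⁻¹ ∈ besselH r σ c J :=
      inv_mem (embedGL_mem_besselH (boldHToGL_mem hc h) (boldHToGL_inv_mem hc h))
    have m1 := mul_mem hDm h.2.1
    have m2 := mul_mem hDm h.2.2.1
    obtain ⟨i2, i1⟩ := integral_rows_and_columns_of_wUnit_eq σ hiso ht A
      (besselH_le_boldH' hc h.2.1) (besselH_le_boldH' hc h.2.2.1) D hM.1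
    have hw : ∀ x : GL (Idx r m) F, x ∈ besselH r σ c J →
        wBlock (x : Matrix (Idx r m) (Idx r m) F) = D →
        wBlock (((embedGL F r m D)⁻¹ * x : GL (Idx r m) F) : Matrix (Idx r m) (Idx r m) F) = 1 := by
      intro x hx hxD
      rw [wBlock_mul hDm hx, hxD, coe_inv_embedGL, wBlock_embedW, ← Units.val_mul, inv_mul_cancel,
        Units.val_one]
    have k1 := isIntegralMatrix_of_rows_and_columns (besselH_le_boldH' hc m1) (hw _ h.2.1 rfl)
      ((integral_rows_iff_columns hiso hG (mem_besselH_iff.1 m1).1.1).2 i1) i1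
    have k2 := isIntegralMatrix_of_rows_and_columns (besselH_le_boldH' hc m2)
      (hw _ h.2.2.1 h.2.2.2.symm) i2
      ((integral_rows_iff_columns hiso hG (mem_besselH_iff.1 m2).1.1).1 i2)
    have e : ((boldHEmbed r σ hc J d)⁻¹ * h).1
        = ((embedGL F r m D)⁻¹ * h.1.1, (embedGL F r m D)⁻¹ * h.1.2) := by
      change ((boldHEmbed r σ hc J d).1)⁻¹ * h.1 = _
      rw [hdh]; rfl
    change ((boldHEmbed r σ hc J d)⁻¹ * h).1 ∈
      (integralGL (Idx r m) F).prod (integralGL (Idx r m) F)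
    rw [e]
    exact ⟨k1, k2⟩

end Unitary

/-! ### Orbital integrals on the symmetric space -/

section Symmetric

variable {F₀ F : Type*} [NormedField F₀] [NormedField F] [NormedAlgebra F₀ F]
variable {r m : ℕ} {σ : F ≃ₐ[F₀] F}

lemma mem_boldH'_iff {h : GL (Idx r m) F} : h ∈ boldH' F₀ F r m ↔
    (h : Matrix (Idx r m) (Idx r m) F) ∈ besselMonoid' F₀ F r m ∧
      ((h⁻¹ : GL (Idx r m) F) : Matrix (Idx r m) (Idx r m) F) ∈ besselMonoid' F₀ F r m :=
  Submonoid.mem_units_iff _ _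

lemma wUnit_mem_range (h : boldH' F₀ F r m) (a b : Fin m) :
    (wUnit F₀ F r m h : Matrix (Fin m) (Fin m) F) a b ∈ (algebraMap F₀ F).range :=
  (mem_boldH'_iff.1 h.2).1.2.2.2.2.2.2 a b

lemma wUnit_inv_mem_range (h : boldH' F₀ F r m) (a b : Fin m) :
    (((wUnit F₀ F r m h)⁻¹ : GL (Fin m) F) : Matrix (Fin m) (Fin m) F) a b
      ∈ (algebraMap F₀ F).range :=
  (mem_boldH'_iff.1 h.2).2.2.2.2.2.2.2 a b

/-- The embedding of `GL_m(F₀)`, in the guise of `𝐇'(F₀)` for `r = 0`, in `𝐇'(F₀)`. -/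
def boldHEmbed' (F₀ F : Type*) [NormedField F₀] [NormedField F] [NormedAlgebra F₀ F] (r m : ℕ) :
    boldH' F₀ F 0 m →* boldH' F₀ F r m where
  toFun h := ⟨embedGL F r m (wUnit F₀ F 0 m h),
    embedGL_mem_boldH' (wUnit_mem_range h) (wUnit_inv_mem_range h)⟩
  map_one' := by simp only [map_one]; rfl
  map_mul' g h := by simp only [map_mul]; rfl

lemma boldH'_zero_eq (h : boldH' F₀ F 0 m) : h.1 = embedGL F 0 m (wUnit F₀ F 0 m h) :=
  (eq_embedGL_wUnit ⟨h.1, boldH'_le_self h.2⟩).trans (congrArg _ (Units.ext rfl))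

lemma map_mem_boldH'_self (σ : F →+* F) {h : GL (Idx r m) F} (hh : h ∈ boldH' F F r m) :
    GeneralLinearGroup.map σ h ∈ boldH' F F r m := by
  have key : ∀ M : Matrix (Idx r m) (Idx r m) F, M ∈ besselMonoid' F F r m →
      M.map σ ∈ besselMonoid' F F r m := by
    rintro M ⟨h1, h2, h3, h4, h5, h6, -⟩
    exact ⟨fun x y hxy => by simp [h1 x y hxy], fun i => by simp [h2], fun i => by simp [h3],
      by simp [h4], fun a => by simp [h5], fun a => by simp [h6], fun _ _ => ⟨_, rfl⟩⟩
  obtain ⟨h1, h2⟩ := mem_boldH'_iff.1 hh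
  exact mem_boldH'_iff.2 ⟨key _ h1, by rw [← map_inv]; exact key _ h2⟩

lemma map_eq_self_of_mem_range {M : Matrix (Fin m) (Fin m) F}
    (hM : ∀ a b, M a b ∈ (algebraMap F₀ F).range) : M.map σ = M := by
  ext a b
  obtain ⟨y, hy⟩ := hM a b
  rw [Matrix.map_apply, ← hy, AlgEquiv.commutes]

lemma det_mem_range {M : Matrix (Fin m) (Fin m) F}
    (hM : ∀ a b, M a b ∈ (algebraMap F₀ F).range) : ∃ y : F₀, algebraMap F₀ F y = M.det := by
  choose N hN using hM
  refine ⟨(Matrix.of N).det, ?_⟩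
  rw [RingHom.map_det]
  congr 1
  ext a b
  exact hN a b

lemma eta_mul_of_norm {x u : F} (hu0 : u ≠ 0) (hu : ∃ z, u = z * σ z) :
    eta σ (x * u) = eta σ x := by
  classical
  obtain ⟨z, rfl⟩ := hu
  have hz : z ≠ 0 := left_ne_zero_of_mul hu0
  have hz' : σ z ≠ 0 := right_ne_zero_of_mul hu0
  refine if_congr ⟨?_, ?_⟩ rfl rfl
  · rintro ⟨w, hw⟩
    refine ⟨w / z, ?_⟩
    rw [map_div₀]
    field_simp
    linear_combination hw
  · rintro ⟨w, rfl⟩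
    exact ⟨w * z, by rw [map_mul]; ring⟩

lemma mem_symSpace_inv_mul_mul_map {ι : Type*} [Fintype ι] [DecidableEq ι] {X : Matrix ι ι F}
    (hX : X ∈ symSpace σ ι) (hσ : ∀ x, σ (σ x) = x) (k : GL ι F) :
    ((k⁻¹ : GL ι F) : Matrix ι ι F) * X * (k : Matrix ι ι F).map σ ∈ symSpace σ ι := by
  have hX' : X * X.map (σ : F →+* F) = 1 := hX
  have hmap : ∀ M : Matrix ι ι F, (M.map (σ : F →+* F)).map (σ : F →+* F) = M := fun M => by
    ext a b; exact hσ _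
  have h1 : k.val.map (σ : F →+* F) * (k⁻¹).val.map (σ : F →+* F) = 1 := by
    rw [← Matrix.map_mul, ← Units.val_mul, mul_inv_cancel, Units.val_one, Matrix.map_one]
    · exact map_zero _
    · exact map_one _
  change (k⁻¹).val * X * k.val.map (σ : F →+* F) *
    ((k⁻¹).val * X * k.val.map (σ : F →+* F)).map (σ : F →+* F) = 1
  rw [Matrix.map_mul, Matrix.map_mul, hmap]
  calc _ = (k⁻¹).val * X * (k.val.map (σ : F →+* F) * (k⁻¹).val.map (σ : F →+* F)) *
        X.map (σ : F →+* F) * k.val := by simp only [Matrix.mul_assoc]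
    _ = (k⁻¹).val * (X * X.map (σ : F →+* F)) * k.val := by
        rw [h1, Matrix.mul_one]; simp only [Matrix.mul_assoc]
    _ = 1 := by rw [hX', Matrix.mul_one, ← Units.val_mul, inv_mul_cancel, Units.val_one]

lemma norm_det_eq_one_of_mem_symSpace (hiso : ∀ x, ‖σ x‖ = ‖x‖) {ι : Type*} [Fintype ι]
    [DecidableEq ι] {M : Matrix ι ι F} (hM : M ∈ symSpace σ ι) : ‖M.det‖ = 1 := by
  have h : M * M.map (σ : F →+* F) = 1 := hM
  have h1 := congrArg (fun X : Matrix ι ι F => ‖X.det‖) h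
  simp only [Matrix.det_mul, norm_mul, norm_det_map (σ := (σ : F →+* F)) hiso, Matrix.det_one,
    norm_one] at h1
  exact (mul_self_eq_one_iff.1 h1).resolve_right fun h2 => by
    have := norm_nonneg M.det
    rw [h2] at this
    norm_num at this

lemma testS_congr {r' : ℕ} {M : Matrix (Idx r m) (Idx r m) F} {M' : Matrix (Idx r' m) (Idx r' m) F}
    (hM : M ∈ symSpace σ (Idx r m)) (hM' : M' ∈ symSpace σ (Idx r' m))
    (h : IsIntegralMatrix M ↔ IsIntegralMatrix M') : testS r m σ M = testS r' m σ M' := by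
  classical
  unfold testS
  exact if_congr (by simp only [hM, hM', h, true_and]) rfl rfl

lemma normalForm_mem_symSpace_iff {t : Fin r → F} (hσ : ∀ x, σ (σ x) = x) (ht : ∀ i, t i ≠ 0)
    (B : Matrix (SharpIdx m) (SharpIdx m) F) :
    normalForm σ t B ∈ symSpace σ (Idx r m) ↔ B * B.map σ = 1 := by
  have ht' : ∀ i, σ (t i) ≠ 0 := fun i => (map_ne_zero σ).2 (ht i)
  constructor
  · intro h
    ext s s'
    have e := congrFun (congrFun (show normalForm σ t B * (normalForm σ t B).map σ = 1 from h)
      (Sum.inr (Sum.inl s))) (Sum.inr (Sum.inl s'))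
    rw [Matrix.mul_apply, Fintype.sum_sum_type, Fintype.sum_sum_type] at e
    simp only [normalForm, Matrix.of_apply, Matrix.map_apply, zero_mul, Finset.sum_const_zero,
      zero_add, add_zero] at e
    rw [Matrix.mul_apply]
    simp only [Matrix.map_apply, e, Matrix.one_apply, Sum.inr.injEq, Sum.inl.injEq]
  · intro h
    change normalForm σ t B * (normalForm σ t B).map σ = 1
    have hB : ∀ s s', ∑ k, B s k * σ (B k s') = (1 : Matrix _ _ F) s s' := fun s s' => by
      rw [← h]; rfl
    ext (i | s | i) (j | s' | j) <;>
      rw [Matrix.mul_apply, Fintype.sum_sum_type, Fintype.sum_sum_type] <;>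
      simp only [normalForm, Matrix.of_apply, Matrix.map_apply, zero_mul, map_zero, mul_zero,
        Finset.sum_const_zero, zero_add, add_zero, hB, Matrix.one_apply, reduceCtorEq, if_false,
        Sum.inr.injEq, Sum.inl.injEq]
    · rcases eq_or_ne i j with rfl | hij
      · simp [hσ, ht]
      · simp [hij]
    · rcases eq_or_ne i j with rfl | hij
      · simp [ht']
      · simp [hij]

variable [IsUltrametricDist F]

/-- The integral points of `𝐇'` as a subgroup. -/
def boldHIntSubgroup' (F₀ F : Type*) [NormedField F₀] [NormedField F] [NormedAlgebra F₀ F]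
    [IsUltrametricDist F] (r m : ℕ) : Subgroup (boldH' F₀ F r m) :=
  (integralGL (Idx r m) F).subgroupOf (boldH' F₀ F r m)

lemma isOpen_boldHIntSubgroup' : IsOpen (boldHIntSubgroup' F₀ F r m : Set (boldH' F₀ F r m)) :=
  (isOpen_integralGL (ι := Idx r m) (F := F)).preimage continuous_subtype_val

lemma comap_boldHEmbed' :
    (boldHIntSubgroup' F₀ F r m).comap (boldHEmbed' F₀ F r m) = boldHIntSubgroup' F₀ F 0 m := by
  ext h
  change embedGL F r m _ ∈ integralGL (Idx r m) F ↔ h.1 ∈ integralGL (Idx 0 m) F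
  rw [boldH'_zero_eq h]
  exact isIntegralMatrix_embedW_iff.trans isIntegralMatrix_embedW_iff.symm

lemma psi_lam'_embedGL_mul_eq_one {ψ₀ : AddChar F₀ ℂ}
    (hψ : ∀ x : F, ‖x‖ ≤ 1 → ψ₀ (Algebra.trace F₀ F x) = 1) (D : GL (Fin m) F)
    {k : GL (Idx r m) F} (hk : IsIntegralMatrix (k : Matrix (Idx r m) (Idx r m) F)) :
    ψ₀ (Algebra.trace F₀ F (lam' ((embedGL F r m D * k : GL (Idx r m) F) :
      Matrix (Idx r m) (Idx r m) F))) = 1 := by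
  refine hψ _ ((IsUltrametricDist.norm_add_le_max _ _).trans (max_le ?_ ?_)) <;>
    refine IsUltrametricDist.norm_sum_le_of_forall_le_of_nonneg zero_le_one fun i _ => ?_
  · rw [Units.val_mul, coe_embedGL, embedW_mul_iE]
    exact hk.1 _ _
  · rw [Units.val_mul, coe_embedGL, embedW_mul_prevD]
    exact hk.1 _ _

lemma norm_det_wBlock_eq_one {k : boldH' F₀ F r m}
    (hk : IsIntegralMatrix (k.1 : Matrix (Idx r m) (Idx r m) F)) :
    ‖(wBlock (k.1 : Matrix (Idx r m) (Idx r m) F)).det‖ = 1 :=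
  (isIntegralMatrix_of_mul_eq_one (M := (wUnit F₀ F r m k).val)
    (N := ((wUnit F₀ F r m k)⁻¹ : GL (Fin m) F).val) (fun a b => hk.1 _ _)
    (fun a b => hk.inv.1 _ _) (by rw [← Units.val_mul, mul_inv_cancel, Units.val_one])).2

/-- Reduction of the orbital integral on the symmetric space of a normal form with unit invariants
to `r = 0`: the integrand is supported on `GL_m(F₀) · 𝐇'(O_{F₀})`. -/
theorem orbS_normalForm_eq [SecondCountableTopology F] (hiso : ∀ x, ‖σ x‖ = ‖x‖)
    (hσ : ∀ x, σ (σ x) = x)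
    (hnorm : ∀ u : F₀, ‖u‖ = 1 → ∃ z : F, algebraMap F₀ F u = z * σ z)
    {ψ₀ : AddChar F₀ ℂ} (hψ : ∀ x : F, ‖x‖ ≤ 1 → ψ₀ (Algebra.trace F₀ F x) = 1)
    (μ : Measure (boldH' F₀ F r m)) [μ.IsMulLeftInvariant] (hμ : μ (boldHInt' F₀ F r m) = 1)
    (μs : Measure (boldH' F₀ F 0 m)) [μs.IsMulLeftInvariant] (hμs : μs (boldHInt' F₀ F 0 m) = 1)
    {t : Fin r → F} (ht : ∀ i, ‖t i‖ = 1) {B : Matrix (SharpIdx m) (SharpIdx m) F}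
    (hγ : normalForm σ t B ∈ symSpace σ (Idx r m)) :
    orbS σ ψ₀ μ (normalForm σ t B) (testS r m σ)
      = orbS σ ψ₀ μs (sharp σ B) (testS 0 m σ) := by
  have := secondCountableTopology_GL (Idx r m) F
  have := secondCountableTopology_GL (Idx 0 m) F
  have : SecondCountableTopology (boldH' F₀ F r m) :=
    Topology.IsEmbedding.subtypeVal.secondCountableTopology
  have : SecondCountableTopology (boldH' F₀ F 0 m) :=
    Topology.IsEmbedding.subtypeVal.secondCountableTopology
  have ht0 : ∀ i, t i ≠ 0 := fun i => norm_ne_zero_iff.1 (by rw [ht]; exact one_ne_zero)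
  have hγs : sharp σ B ∈ symSpace σ (Idx 0 m) :=
    (normalForm_mem_symSpace_iff hσ (fun i => i.elim0) B).2
      ((normalForm_mem_symSpace_iff hσ ht0 B).1 hγ)
  have psi1 : ∀ (r' : ℕ) (D : GL (Fin m) F), ψ₀ (Algebra.trace F₀ F
      (lam' (embedGL F r' m D : Matrix (Idx r' m) (Idx r' m) F))) = 1 := fun r' D => by
    simpa only [mul_one] using
      psi_lam'_embedGL_mul_eq_one hψ D (r := r') (k := 1) isIntegralMatrix_one
  have hDσ : ∀ {r' : ℕ} (d : boldH' F₀ F r' m),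
      (wUnit F₀ F r' m d : Matrix (Fin m) (Fin m) F).map (σ : F →+* F)
        = (wUnit F₀ F r' m d : Matrix (Fin m) (Fin m) F) := fun d =>
    map_eq_self_of_mem_range (σ := σ) (wUnit_mem_range d)
  refine integral_eq_integral_comp_of_support μ μs (boldHIntSubgroup' F₀ F r m)
    (boldHIntSubgroup' F₀ F 0 m) isOpen_boldHIntSubgroup' isOpen_boldHIntSubgroup' hμ hμs
    (boldHEmbed' F₀ F r m) comap_boldHEmbed' _ _ ?_ ?_ ?_
  · intro d
    have hd := hDσ d
    have e1 : (boldHEmbed' F₀ F r m d).1 = embedGL F r m (wUnit F₀ F 0 m d) := rfl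
    rw [e1, boldH'_zero_eq d]
    set D := wUnit F₀ F 0 m d
    rw [psi1, psi1, coe_embedGL, coe_embedGL, wBlock_embedW, wBlock_embedW]
    congr 2
    have u1 := mem_symSpace_inv_mul_mul_map hγ hσ (embedGL F r m D)
    have u2 := mem_symSpace_inv_mul_mul_map hγs hσ (embedGL F 0 m D)
    -- Determinants on the symmetric space are units, so only the entries of `D⁻¹BD` matter.
    refine testS_congr u1 u2 ?_
    have n1 := norm_det_eq_one_of_mem_symSpace hiso u1
    have n2 := norm_det_eq_one_of_mem_symSpace hiso u2
    have E : ∀ r' : ℕ, ∀ t' : Fin r' → F,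
        ((embedGL F r' m D)⁻¹).val * normalForm σ t' B * (embedW r' D.val).map σ
          = normalForm σ t' (fromBlocks 1 0 0 (D⁻¹).val * B * fromBlocks 1 0 0 D.val) := by
      intro r' t'
      rw [← embedW_mul_normalForm_mul_embedW, coe_inv_embedGL]
      congr 1
      exact (embedW_map (σ : F →+* F) D.val).trans (by rw [hd])
    rw [coe_embedGL, E] at n1
    rw [coe_embedGL, sharp, E] at n2
    rw [sharp, E, E, IsIntegralMatrix, IsIntegralMatrix, norm_normalForm_apply_le_one_iff hiso ht,
      norm_normalForm_apply_le_one_iff hiso (fun i => i.elim0)]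
    exact and_congr_right fun _ => by rw [n1, n2]
  · intro d k hk
    change IsIntegralMatrix k.1.val at hk
    have e1 : (boldHEmbed' F₀ F r m d).1 = embedGL F r m (wUnit F₀ F 0 m d) := rfl
    have e2 : (boldHEmbed' F₀ F r m d * k).1 = embedGL F r m (wUnit F₀ F 0 m d) * k.1 := rfl
    have w : wBlock (boldHEmbed' F₀ F r m d * k).1.val
        = (wUnit F₀ F 0 m d).val * wBlock k.1.val := by
      rw [Subgroup.coe_mul, Units.val_mul, wBlock_mul_of_mem
        (mem_boldH'_iff.1 (boldHEmbed' F₀ F r m d).2).1 (mem_boldH'_iff.1 k.2).1, e1, coe_embedGL,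
        wBlock_embedW]
    have hk1 := norm_det_wBlock_eq_one hk
    obtain ⟨u, hu⟩ := det_mem_range (wUnit_mem_range k)
    rw [coe_wUnit] at hu
    rw [w, e2, e1, Matrix.det_mul, coe_embedGL, wBlock_embedW, eta_mul_of_norm
      (norm_ne_zero_iff.1 (by rw [hk1]; exact one_ne_zero))
      (hu ▸ hnorm u (by rw [← norm_algebraMap' F, hu, hk1])), psi_lam'_embedGL_mul_eq_one hψ _ hk]
    rw [← coe_embedGL, psi1]
    congr 2
    set D := wUnit F₀ F 0 m d
    have u1 := mem_symSpace_inv_mul_mul_map hγ hσ (embedGL F r m D)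
    have hkσ : IsIntegralMatrix (GeneralLinearGroup.map (σ : F →+* F) k.1).val :=
      IsIntegralMatrix.map (σ := (σ : F →+* F)) hiso hk
    have e3 : ((embedGL F r m D * k.1)⁻¹ : GL (Idx r m) F).val * normalForm σ t B *
        (embedGL F r m D * k.1 : GL (Idx r m) F).val.map σ
        = (k.1⁻¹).val * (((embedGL F r m D)⁻¹).val * normalForm σ t B *
          (embedGL F r m D).val.map σ) * (GeneralLinearGroup.map (σ : F →+* F) k.1).val := by
      have : (embedGL F r m D * k.1 : GL (Idx r m) F).val.map σ = (embedGL F r m D).val.map σ *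
          (GeneralLinearGroup.map (σ : F →+* F) k.1).val := by
        rw [Units.val_mul]
        exact Matrix.map_mul (f := (σ : F →+* F))
      rw [this, _root_.mul_inv_rev, Units.val_mul]
      simp only [Matrix.mul_assoc]
    rw [e3]
    exact testS_congr (mem_symSpace_inv_mul_mul_map u1 hσ k.1) u1
      (isIntegralMatrix_inv_mul_mul_iff hk hkσ)
  · intro h hh
    have hT := left_ne_zero_of_mul (left_ne_zero_of_mul hh)
    unfold testS at hT
    classical
    rw [ite_ne_right_iff] at hT
    obtain ⟨⟨-, hM⟩, -⟩ := hT
    have hd := hDσ h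
    set D := wUnit F₀ F r m h with hD
    have hDm : embedGL F r m D ∈ boldH' F₀ F r m :=
      embedGL_mem_boldH' (wUnit_mem_range h) (wUnit_inv_mem_range h)
    let d : boldH' F₀ F 0 m := ⟨embedGL F 0 m D,
      embedGL_mem_boldH' (wUnit_mem_range h) (wUnit_inv_mem_range h)⟩
    have hdD : wUnit F₀ F 0 m d = D := Units.ext rfl
    have hdh : (boldHEmbed' F₀ F r m d).1 = embedGL F r m D := by rw [← hdD]; rfl
    refine ⟨d, (boldHEmbed' F₀ F r m d)⁻¹ * h, ?_, by group⟩
    have hh' := boldH'_le_self h.2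
    obtain ⟨i2, i1⟩ := integral_rows_and_columns_of_wUnit_eq σ hiso ht B hh'
      (map_mem_boldH'_self (σ : F →+* F) hh') D hM.1
    -- As `D` has entries in `F₀`, conjugation commutes with splitting off `D`.
    have hDbar : GeneralLinearGroup.map (σ : F →+* F) (embedGL F r m D) = embedGL F r m D :=
      Units.ext ((embedW_map (σ : F →+* F) D.val).trans (by rw [hd]; rfl))
    have i2' : ∀ k y, ‖((embedGL F r m D)⁻¹ * h.1 : GL (Idx r m) F).val (iE k) y‖ ≤ 1 := by
      intro k y
      have h2 := i2 k y
      rw [← hDbar, ← map_inv, ← map_mul] at h2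
      rw [← hiso]
      exact h2
    have hm := mul_mem (inv_mem hDm) h.2
    have hw : wBlock ((embedGL F r m D)⁻¹ * h.1 : GL (Idx r m) F).val = 1 := by
      rw [Units.val_mul, wBlock_mul_of_mem (mem_boldH'_iff.1 (inv_mem hDm)).1
        (mem_boldH'_iff.1 h.2).1, coe_inv_embedGL, wBlock_embedW, ← coe_wUnit, ← hD,
        ← Units.val_mul, inv_mul_cancel, Units.val_one]
    have k1 := isIntegralMatrix_of_rows_and_columns (boldH'_le_self hm) hw i2' i1
    change ((boldHEmbed' F₀ F r m d).1)⁻¹ * h.1 ∈ integralGL (Idx r m) F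
    rw [hdh]
    exact k1

end Symmetric

/-! ### The lattice generated by `E` and its translate -/

section Lattice

variable {F₀ F : Type*} [NormedField F₀] [NormedField F] [NormedAlgebra F₀ F]
variable {r m : ℕ} {σ : F ≃ₐ[F₀] F} {c : F} {J : Matrix (Fin m) (Fin m) F}

lemma herm_gram_of_sharp_eq_zero {x : Idx r m → F} (hx : ∀ s, x (Sum.inr (Sum.inl s)) = 0)
    (y : Idx r m → F) : herm σ (gram c J) x y
      = ∑ i, σ (x (iE i)) * y (iD i) + ∑ i, σ (x (iD i)) * y (iE i) := by
  simp [herm, dotProduct, mulVec, Fintype.sum_sum_type, gram, hx]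

lemma mem_flatLattice_iff (hiso : ∀ x, ‖σ x‖ = ‖x‖) {t : Fin r → F} (ht : ∀ i, t i ≠ 0)
    (A : Matrix (SharpIdx m) (SharpIdx m) F) (x : Idx r m → F) :
    x ∈ flatLattice (normalForm σ t A) ↔ (∀ s, x (Sum.inr (Sum.inl s)) = 0) ∧
      (∀ i, ‖x (iE i)‖ ≤ 1) ∧ ∀ i, ‖x (iD i)‖ * ‖t i‖ ≤ 1 := by
  have ht' : ∀ i, σ (t i) ≠ 0 := fun i => (map_ne_zero σ).2 (ht i)
  constructor
  · rintro ⟨a, ha, rfl⟩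
    refine ⟨fun s => ?_, fun i => ?_, fun i => ?_⟩
    · simp [Fintype.sum_sum_type, normalForm]
    · simpa [Fintype.sum_sum_type, normalForm, Pi.single_apply] using ha (Sum.inl i)
    · have h := ha (Sum.inr i)
      simpa [Fintype.sum_sum_type, normalForm, hiso, ht i] using h
  · rintro ⟨h0, hE, hD⟩
    refine ⟨Sum.elim (fun i => x (iE i)) fun i => x (iD i) * σ (t i), ?_, ?_⟩
    · rintro (i | i)
      · exact hE i
      · simpa [hiso] using hD i
    · ext (i | s | i)
      · simp [Fintype.sum_sum_type, normalForm, Pi.single_apply]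
      · simp [Fintype.sum_sum_type, normalForm, h0]
      · simp [Fintype.sum_sum_type, normalForm, ht' i]

/-- In coordinates, the dual lattice is cut out by `‖x_E‖ ≤ ‖t‖` and `‖x_{E^∨}‖ ≤ 1`, the lattice
itself by `‖x_E‖ ≤ 1` and `‖x_{E^∨}‖ ≤ ‖t‖⁻¹`. -/
theorem isUnimodularLattice_flatLattice_iff [IsUltrametricDist F] (hiso : ∀ x, ‖σ x‖ = ‖x‖)
    {t : Fin r → F} (ht : ∀ i, t i ≠ 0) (A : Matrix (SharpIdx m) (SharpIdx m) F) :
    IsUnimodularLattice σ (gram c J) (flatLattice (normalForm σ t A)) ↔ ∀ i, ‖t i‖ = 1 := by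
  have mem := mem_flatLattice_iff hiso ht A
  have hE : ∀ i, (Pi.single (iE i) 1 : Idx r m → F) ∈ flatLattice (normalForm σ t A) := by
    intro i
    rw [mem]
    refine ⟨fun s => by simp, fun j => ?_, fun j => by simp⟩
    rw [Pi.single_apply]
    split_ifs <;> simp
  have hD : ∀ i, (Pi.single (iD i) (t i)⁻¹ : Idx r m → F) ∈ flatLattice (normalForm σ t A) := by
    intro i
    rw [mem]
    refine ⟨fun s => by simp, fun j => by simp, fun j => ?_⟩
    rcases eq_or_ne j i with rfl | hij
    · simp [ht]
    · simp [hij]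
  have hspan : ∀ x ∈ Submodule.span F (flatLattice (normalForm σ t A)),
      ∀ s, x (Sum.inr (Sum.inl s)) = 0 := by
    intro x hx s
    induction hx using Submodule.span_induction with
    | mem x hx => exact ((mem x).1 hx).1 s
    | zero => rfl
    | add x y _ _ h1 h2 => rw [Pi.add_apply, h1, h2, add_zero]
    | smul a x _ h => rw [Pi.smul_apply, h, smul_zero]
  constructor
  · intro h i
    refine le_antisymm ?_ ?_
    · have hin : (Pi.single (iD i) 1 : Idx r m → F) ∈ flatLattice (normalForm σ t A) := by
        refine (h _ ?_).1 fun y hy => ?_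
        · have := Submodule.smul_mem _ (t i) (Submodule.subset_span (R := F) (hD i))
          rwa [← Pi.single_smul, smul_eq_mul, mul_inv_cancel₀ (ht i)] at this
        · rw [herm_gram_of_sharp_eq_zero (fun s => by simp)]
          have : ∑ j, σ ((Pi.single (iD i) 1 : Idx r m → F) (iD j)) * y (iE j) = y (iE i) := by
            rw [Finset.sum_eq_single i]
            · simp
            · intro j _ hj; simp [hj]
            · simp
          rw [this]
          simpa using ((mem y).1 hy).2.1 i
      simpa using ((mem _).1 hin).2.2 i
    · have hd := (h _ (Submodule.subset_span (hE i))).2 (hE i) _ (hD i)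
      rw [herm_gram_of_sharp_eq_zero (fun s => by simp), Finset.sum_eq_single i] at hd
      · have h1 : ‖t i‖⁻¹ ≤ 1 := by simpa using hd
        exact (inv_le_one₀ (norm_pos_iff.2 (ht i))).1 h1
      · intro j _ hj; simp [hj]
      · simp
  · intro h1 x hx
    have h0 := hspan x hx
    have hsum : ∀ f : Fin r → F, (∀ i, ‖f i‖ ≤ 1) → ‖∑ i, f i‖ ≤ 1 := fun f hf =>
      IsUltrametricDist.norm_sum_le_of_forall_le_of_nonneg zero_le_one fun i _ => hf i
    rw [mem]
    simp only [h1, mul_one]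
    constructor
    · intro h
      refine ⟨h0, fun i => ?_, fun i => ?_⟩
      · have hi := h _ (hD i)
        rw [herm_gram_of_sharp_eq_zero h0, Finset.sum_eq_single i] at hi
        · simpa [hiso, h1] using hi
        · intro j _ hj; simp [hj]
        · simp
      · have hi := h _ (hE i)
        rw [herm_gram_of_sharp_eq_zero h0, add_comm, Finset.sum_eq_single i] at hi
        · simpa [hiso] using hi
        · intro j _ hj; simp [hj]
        · simp
    · rintro ⟨-, hxE, hxD⟩ y hy
      obtain ⟨-, hyE, hyD⟩ := (mem y).1 hy
      simp only [h1, mul_one] at hyD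
      rw [herm_gram_of_sharp_eq_zero h0]
      refine (IsUltrametricDist.norm_add_le_max _ _).trans
        (max_le (hsum _ fun i => ?_) (hsum _ fun i => ?_)) <;> rw [norm_mul, hiso]
      · exact mul_le_one₀ (hxE i) (norm_nonneg _) (hyD i)
      · exact mul_le_one₀ (hxD i) (norm_nonneg _) (hyE i)

/-! ### Transfer factors -/

lemma normalForm_pow_apply_sharp (t : Fin r → F) (B : Matrix (SharpIdx m) (SharpIdx m) F) (k : ℕ)
    (x y : SharpIdx m) :
    (normalForm σ t B ^ k) (Sum.inr (Sum.inl x)) (Sum.inr (Sum.inl y)) = (B ^ k) x y := by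
  induction k generalizing y with
  | zero => simp [Matrix.one_apply]
  | succ k ih =>
    rw [pow_succ, pow_succ, Matrix.mul_apply, Matrix.mul_apply, Fintype.sum_sum_type,
      Fintype.sum_sum_type]
    simp only [ih]
    simp [normalForm]

lemma transferFactor_normalForm (t : Fin r → F) (B : Matrix (SharpIdx m) (SharpIdx m) F) :
    transferFactor (normalForm σ t B) = transferFactor (sharp σ B) := by
  have h : (Matrix.of fun x y : SharpIdx m =>
        (normalForm σ t B ^ (Sum.elim (fun _ => 0) (fun a : Fin m => a.1 + 1) y : ℕ))
          (Sum.inr (Sum.inl x)) iL) =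
      Matrix.of fun x y : SharpIdx m =>
        (sharp σ B ^ (Sum.elim (fun _ => 0) (fun a : Fin m => a.1 + 1) y : ℕ))
          (Sum.inr (Sum.inl x)) iL := by
    ext x y
    exact (normalForm_pow_apply_sharp t B _ x _).trans
      (normalForm_pow_apply_sharp Fin.elim0 B _ x _).symm
  unfold transferFactor
  rw [h]

end Lattice

/-! ### Local fields -/

section LocalField

variable {p : ℕ} [Fact p.Prime] {K : Type*} [NormedField K] [NormedAlgebra ℚ_[p] K]

lemma isUltrametricDist_of_normedAlgebra_padic (p : ℕ) [Fact p.Prime] (K : Type*) [NormedField K]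
    [NormedAlgebra ℚ_[p] K] : IsUltrametricDist K :=
  IsUltrametricDist.isUltrametricDist_of_forall_norm_natCast_le_one fun n => by
    rw [← map_natCast (algebraMap ℚ_[p] K), norm_algebraMap']
    exact IsUltrametricDist.norm_natCast_le_one ℚ_[p] n

lemma norm_two_eq_one_of_ne_two (hp : p ≠ 2) : ‖(2 : K)‖ = 1 := by
  have h2 : ((2 : ℕ) : K) = algebraMap ℚ_[p] K (2 : ℕ) := (map_natCast _ _).symm
  rw [← Nat.cast_ofNat, h2, norm_algebraMap', Padic.norm_natCast_eq_one_iff]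
  exact (Nat.coprime_primes Fact.out Nat.prime_two).2 hp

end LocalField

end BesselFL

open BesselFL in
theorem mainTheorem7 {p : ℕ} [Fact p.Prime] (hp : p ≠ 2)
    {F₀ F : Type*} [NormedField F₀] [NormedAlgebra ℚ_[p] F₀] [FiniteDimensional ℚ_[p] F₀]
    [NormedField F] [NormedAlgebra F₀ F]
    (hdeg : Module.finrank F₀ F = 2) (hunram : ∀ x : F, ∃ y : F₀, ‖x‖ = ‖y‖)
    (σ : F ≃ₐ[F₀] F) (hσ : σ ≠ AlgEquiv.refl)
    (ψ₀ : AddChar F₀ ℂ) (hψcont : Continuous ψ₀) (hψ : BesselFL.IsLevelZero ψ₀)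
    (r m : ℕ) (hm : 1 ≤ m)
    (c : F) (hc : σ c = c) (hc1 : ‖c‖ = 1)
    (J : Matrix (Fin m) (Fin m) F) (hJ : BesselFL.IsHermitianMatrix σ J)
    (hJ' : BesselFL.IsSplitGram J ∨ BesselFL.IsNonsplitGram σ J)
    (μ : MeasureTheory.Measure (BesselFL.boldH r σ c J)) [μ.IsHaarMeasure]
    (hμ : μ (BesselFL.boldHInt r σ c J) = 1)
    (μs : MeasureTheory.Measure (BesselFL.boldH 0 σ c J)) [μs.IsHaarMeasure]
    (hμs : μs (BesselFL.boldHInt 0 σ c J) = 1)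
    (μ' : MeasureTheory.Measure (BesselFL.boldH' F₀ F r m)) [μ'.IsHaarMeasure]
    (hμ' : μ' (BesselFL.boldHInt' F₀ F r m) = 1)
    (μs' : MeasureTheory.Measure (BesselFL.boldH' F₀ F 0 m)) [μs'.IsHaarMeasure]
    (hμs' : μs' (BesselFL.boldHInt' F₀ F 0 m) = 1)
    (t : Fin r → F) (A : Matrix (BesselFL.SharpIdx m) (BesselFL.SharpIdx m) F)
    (hg : BesselFL.IsRegularNormalFormU σ c J t A) :
    (BesselFL.IsUnimodularLattice σ (BesselFL.gram c J)
        (BesselFL.flatLattice (BesselFL.normalForm σ t A)) ↔ ∀ i, ‖t i‖ = 1) ∧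
    (BesselFL.IsUnimodularLattice σ (BesselFL.gram c J)
        (BesselFL.flatLattice (BesselFL.normalForm σ t A)) →
      BesselFL.orbU σ c J ψ₀ μ (BesselFL.normalForm σ t A) (BesselFL.testU r σ c J) =
        BesselFL.orbU σ c J ψ₀ μs (BesselFL.sharp σ A) (BesselFL.testU 0 σ c J) ∧
      (∀ (t' : Fin r → F) (B : Matrix (BesselFL.SharpIdx m) (BesselFL.SharpIdx m) F),
        BesselFL.IsRegularNormalFormS σ t' B → BesselFL.Matches t A t' B →
        BesselFL.transferFactor (BesselFL.normalForm σ t' B) *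
            BesselFL.orbS σ ψ₀ μ' (BesselFL.normalForm σ t' B) (BesselFL.testS r m σ) =
          BesselFL.transferFactor (BesselFL.sharp σ B) *
            BesselFL.orbS σ ψ₀ μs' (BesselFL.sharp σ B) (BesselFL.testS 0 m σ)) ∧
      (BesselFL.FundamentalLemmaAt σ c J ψ₀ μ μ' t A ↔
        BesselFL.FundamentalLemmaAt σ c J ψ₀ μs μs' Fin.elim0 A)) := by
  have hnt : ∃ x : F₀, 1 < ‖x‖ := by
    obtain ⟨x, hx⟩ := NormedField.exists_one_lt_norm ℚ_[p]
    exact ⟨algebraMap ℚ_[p] F₀ x, by rwa [norm_algebraMap']⟩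
  have hu₀ : IsUltrametricDist F₀ := isUltrametricDist_of_normedAlgebra_padic p F₀
  have hu : IsUltrametricDist F := IsUltrametricDist.isUltrametricDist_of_forall_norm_natCast_le_one
    fun n => by
      rw [← map_natCast (algebraMap F₀ F), norm_algebraMap']
      exact IsUltrametricDist.norm_natCast_le_one F₀ n
  have hprop₀ : ProperSpace F₀ := FiniteDimensional.proper ℚ_[p] F₀
  have hfin : FiniteDimensional F₀ F := FiniteDimensional.of_finrank_pos (by omega)
  have hprop : ProperSpace F := by
    let : NontriviallyNormedField F₀ := { ‹NormedField F₀› with non_trivial := hnt }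
    exact FiniteDimensional.proper F₀ F
  have hiso' : ∀ (τ : F ≃ₐ[F₀] F) (x : F), ‖τ x‖ = ‖x‖ := norm_algEquiv_apply hnt
  have hiso := hiso' σ
  have hσσ := apply_apply_of_finrank_eq_two hdeg hσ
  have hgal : IsGalois F₀ F := (isGalois_of_finrank_eq_two hdeg hσ).1
  have hψ' : ∀ x : F, ‖x‖ ≤ 1 → ψ₀ (Algebra.trace F₀ F x) = 1 := fun x hx =>
    hψ.1 _ (norm_trace_le_one hiso' hx)
  have hnorm : ∀ u : F₀, ‖u‖ = 1 → ∃ z : F, algebraMap F₀ F u = z * σ z := fun u =>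
    exists_eq_mul_apply_of_norm_eq_one hnt (norm_two_eq_one_of_ne_two (p := p) hp) hdeg hunram hσ
  have hlat := isUnimodularLattice_flatLattice_iff (c := c) (J := J) hiso hg.2.1 A
  refine ⟨hlat, fun hΛ => ?_⟩
  have ht := hlat.1 hΛ
  have hU := orbU_normalForm_eq hiso hψ' hc1 μ hμ μs hμs ht hg.1
  have hS : ∀ B : Matrix (SharpIdx m) (SharpIdx m) F, IsRegularNormalFormS σ t B →
      transferFactor (normalForm σ t B) * orbS σ ψ₀ μ' (normalForm σ t B) (testS r m σ) =
        transferFactor (sharp σ B) * orbS σ ψ₀ μs' (sharp σ B) (testS 0 m σ) := fun B hB => by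
    rw [transferFactor_normalForm, orbS_normalForm_eq hiso hσσ hnorm hψ' μ' hμ' μs' hμs' ht hB.1]
  have hreg : ∀ B : Matrix (SharpIdx m) (SharpIdx m) F,
      IsRegularNormalFormS σ t B ↔ IsRegularNormalFormS σ (Fin.elim0 : Fin 0 → F) B := fun B => by
    rw [IsRegularNormalFormS, IsRegularNormalFormS, normalForm_mem_symSpace_iff hσσ hg.2.1,
      normalForm_mem_symSpace_iff hσσ (fun i => i.elim0)]
    simp only [hg.2.1, ne_eq, not_false_eq_true, implies_true, IsEmpty.forall_iff]
  refine ⟨hU, ?_, ?_, ?_⟩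
  · rintro t' B hB ⟨rfl, -⟩
    exact hS B hB
  · rintro h t' B hB ⟨rfl, hD⟩
    have hB' := (hreg B).2 hB
    exact hU.symm.trans ((h t B hB' ⟨rfl, hD⟩).trans (hS B hB'))
  · rintro h t' B hB ⟨rfl, hD⟩
    exact hU.trans ((h Fin.elim0 B ((hreg B).1 hB) ⟨rfl, hD⟩).trans (hS B hB).symm)
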